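/- **Truth values.** Let $\mathbf 4=\{1,\mathbf b,\mathbf n,0\}$, ordered as a lattice with least element $0$, greatest element $1$ and $\mathbf b,\mathbf n$ incomparable; let $\wedge,\vee$ be its meet and join. Let $\neg 1=0$, $\neg\mathbf b=\mathbf b$, $\neg\mathbf n=\mathbf n$, $\neg 0=1$, and $\copyright 1=1$, $\copyright\mathbf b=0$, $\copyright\mathbf n=\mathbf b$, $\copyright 0=1$. Let $1\to y=\mathbf b\to y=y$ and $0\to y=1$ for all $y$, and $\mathbf n\to 1=1$, $\mathbf n\to\mathbf b=\mathbf b$, $\mathbf n\to\mathbf n=1$, $\mathbf n\to 0=\mathbf b$. The designated values are $1$ and $\mathbf b$. **Language and semantics.** Let $\mathcal S$ be a first-order signature (predicate, function and constant symbols, of any cardinality), with a denumerable set of variables. Formulas are built from atomic formulas $P(t_1,\dots,t_n)$ by $\wedge,\vee,\to,\neg,\copyright,\forall,\exists$. A $\mathbf 4$-structure $\mathfrak A$ consists of a non-empty set $A$, a function $A^n\to\mathbf 4$ for each $n$-ary predicate symbol, a function $A^n\to A$ for each $n$-ary function symbol, and an element of $A$ for each constant symbol. For an assignment $s$ of elements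 of $A$ to the variables, the value $\|\varphi\|(s)\in\mathbf 4$ is defined recursively: an atomic formula takes the value of its predicate at the values of its terms, connectives are interpreted by the operations of $\mathbf 4$, and $\|\forall x\varphi\|(s)=\inf_{a\in A}\|\varphi\|(s_x^a)$, $\|\exists x\varphi\|(s)=\sup_{a\in A}\|\varphi\|(s_x^a)$, where $s_x^a$ is $s$ with the value at $x$ changed to $a$. $\mathfrak A$ is a model of $\varphi$ if $\|\varphi\|(s)\in\{1,\mathbf b\}$ for every assignment $s$. Write $\Delta\models_{\sf QBD2}\varphi$ if every $\mathbf 4$-structure that is a model of all formulas of $\Delta$ is a model of $\varphi$. **Calculus.** ${\sf HQBD2}$ is the Hilbert calculus over the formulas without $\exists$ with the following axiom schemata, where $\alpha\leftrightarrow\beta$ abbreviates $(\alpha\to\beta)\wedge(\beta\to\alpha)$: * $\alpha\to(\beta\to\alpha)$; $\ (\alpha\to(\beta\to\gamma))\to((\alpha\to\beta)\to(\alpha\to\gamma))$; $\ \alpha\wedge\beta\to\alpha$; $\ \alpha\wedge\beta\to\beta$; $\ \alpha\to(\beta\to(\alpha\wedge\beta))$; $\ \alpha\to(\alpha\vee\beta)$;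 $\ \alpha\to(\beta\vee\alpha)$; $\ (\alpha\to\gamma)\to((\beta\to\gamma)\to(\alpha\vee\beta\to\gamma))$; $\ \alpha\vee(\alpha\to\beta)$; * $\neg\neg\alpha\leftrightarrow\alpha$; $\ \neg(\alpha\vee\beta)\leftrightarrow(\neg\alpha\wedge\neg\beta)$; $\ \neg(\alpha\wedge\beta)\leftrightarrow(\neg\alpha\vee\neg\beta)$; $\ \neg(\alpha\to\beta)\leftrightarrow((\neg\alpha\to\alpha)\wedge\neg\beta)$; * $(\copyright\alpha\wedge(\alpha\wedge\neg\alpha))\to\beta$; $\ \copyright\alpha\vee(\alpha\wedge\neg\alpha)$; $\ \neg\copyright\alpha\leftrightarrow(\alpha\leftrightarrow\neg\alpha)$; * $\forall x\varphi\to\varphi[x/t]$ and $\neg\varphi[x/t]\to\neg\forall x\varphi$, where $t$ is a term free for $x$ in $\varphi$ and $\varphi[x/t]$ is the result of replacing the free occurrences of $x$ by $t$; $\ \neg\forall x\varphi\to\neg\forall x\neg\neg\varphi$; and the rules: modus ponens; from $\alpha\to\beta$ infer $\alpha\to\forall x\beta$, and from $\beta\to\alpha$ infer $\neg\forall x\neg\beta\to\alpha$,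 both provided that $x$ is not free in $\alpha$. Write $\Delta\vdash_{\sf HQBD2}\varphi$ if there is a derivation of $\varphi$ in which formulas of $\Delta$ may be used as premises. **Theorem (Adequacy).** For every signature $\mathcal S$, every set $\Delta$ of formulas without $\exists$ and every formula $\varphi$ without $\exists$, possibly with free variables (so in particular for sentences), $$\Delta\models_{\sf QBD2}\varphi\quad\Longleftrightarrow\quad\Delta\vdash_{\sf HQBD2}\varphi .$$ For arbitrary $\Delta$ and $\varphi$, possibly containing $\exists$, the same equivalence holds when in the right-hand side each $\exists x\psi$ is read as the abbreviation of $\neg\forall x\neg\psi$. -/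

import Mathlib

universe u v w

namespace QBD2

/-! ### The four truth values and the matrix of BD2 -/

/-- The set of truth values `{1, b, n, 0}`. -/
inductive Four : Type
  | one
  | b
  | n
  | zero
  deriving DecidableEq

namespace Four

instance : Fintype Four := ⟨{one, b, n, zero}, fun x => by cases x <;> decide⟩

/-- The truth table of conjunction. -/
def and : Four → Four → Four
  | one, y => y
  | b, one => b
  | b, b => b
  | b, n => zero
  | b, zero => zero
  | n, one => n
  | n, b => zero
  | n, n => n
  | n, zero => zero
  | zero, _ => zero

/-- The truth table of disjunction. -/
def or : Four → Four → Four
  | one, _ => one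
  | b, one => one
  | b, b => b
  | b, n => one
  | b, zero => b
  | n, one => one
  | n, b => one
  | n, n => n
  | n, zero => n
  | zero, y => y

/-- The truth table of the negation `¬`. -/
def neg : Four → Four
  | one => zero
  | b => b
  | n => n
  | zero => one

/-- The truth table of the implication `→`. -/
def imp : Four → Four → Four
  | one, y => y
  | b, y => y
  | n, one => one
  | n, b => b
  | n, n => one
  | n, zero => b
  | zero, _ => one

/-- The truth table of the weak consistency operator `©`. -/
def cons : Four → Four
  | one => one
  | b => zero
  | n => b
  | zero => one

/-- The designated values are `1` and `b`. -/
def designated : Set Four := {one, b}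

/-- The lattice order of `4`: `0` is the least element, `1` the greatest, and `b`, `n` are
incomparable. It is the order determined by the table of conjunction. -/
instance : LE Four := ⟨fun x y => and x y = x⟩

instance : DecidableRel (α := Four) (· ≤ ·) :=
  fun x y => inferInstanceAs (Decidable (and x y = x))

instance : Lattice Four where
  le_refl := by decide
  le_trans := by decide
  le_antisymm := by decide
  sup := or
  inf := and
  le_sup_left := by decide
  le_sup_right := by decide
  sup_le := by decide
  inf_le_left := by decide
  inf_le_right := by decide
  le_inf := by decide

instance : BoundedOrder Four where
  top := one
  bot := zero
  le_top := by decide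
  bot_le := by decide

/-- The finite lattice `4` is complete; this provides `⨅` and `⨆`. -/
noncomputable instance : CompleteLattice Four := Fintype.toCompleteLattice Four

end Four

/-! ### Syntax

A first-order signature is a `FirstOrder.Language`; its constant symbols are the function symbols
of arity `0`. The individual variables are the natural numbers, and terms are `L.Term ℕ`. -/

/-- Formulas of the language `L(∀, ∃, {∧, ∨, →, ¬, ©}, S)`. -/
inductive Formula (L : FirstOrder.Language.{u, v}) : Type (max u v)
  | rel {k : ℕ} (P : L.Relations k) (ts : Fin k → L.Term ℕ) : Formula L
  | and (φ ψ : Formula L) : Formula L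
  | or (φ ψ : Formula L) : Formula L
  | imp (φ ψ : Formula L) : Formula L
  | neg (φ : Formula L) : Formula L
  | cons (φ : Formula L) : Formula L
  | all (x : ℕ) (φ : Formula L) : Formula L
  | ex (x : ℕ) (φ : Formula L) : Formula L

/-- Formulas of the language `L(∀, {∧, ∨, →, ¬, ©}, S)`, over which the calculus is defined. -/
inductive UFormula (L : FirstOrder.Language.{u, v}) : Type (max u v)
  | rel {k : ℕ} (P : L.Relations k) (ts : Fin k → L.Term ℕ) : UFormula L
  | and (φ ψ : UFormula L) : UFormula L
  | or (φ ψ : UFormula L) : UFormula L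
  | imp (φ ψ : UFormula L) : UFormula L
  | neg (φ : UFormula L) : UFormula L
  | cons (φ : UFormula L) : UFormula L
  | all (x : ℕ) (φ : UFormula L) : UFormula L

namespace UFormula

variable {L : FirstOrder.Language.{u, v}}

/-- The inclusion of the language with `∀` only into the language with both quantifiers. -/
def toFormula : UFormula L → Formula L
  | rel P ts => .rel P ts
  | and φ ψ => .and φ.toFormula ψ.toFormula
  | or φ ψ => .or φ.toFormula ψ.toFormula
  | imp φ ψ => .imp φ.toFormula ψ.toFormula
  | neg φ => .neg φ.toFormula
  | cons φ => .cons φ.toFormula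
  | all x φ => .all x φ.toFormula

/-- `α ↔ β` abbreviates `(α → β) ∧ (β → α)`. -/
def iff (α β : UFormula L) : UFormula L := (α.imp β).and (β.imp α)

/-- The variables that occur free in a formula. -/
def freeVars : UFormula L → Finset ℕ
  | rel _ ts => Finset.univ.biUnion fun i => (ts i).varFinset
  | and φ ψ => φ.freeVars ∪ ψ.freeVars
  | or φ ψ => φ.freeVars ∪ ψ.freeVars
  | imp φ ψ => φ.freeVars ∪ ψ.freeVars
  | neg φ => φ.freeVars
  | cons φ => φ.freeVars
  | all x φ => φ.freeVars.erase x

/-- `φ.subst x t` replaces every free occurrence of the variable `x` in `φ` by the term `t`. -/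
def subst (x : ℕ) (t : L.Term ℕ) : UFormula L → UFormula L
  | rel P ts => rel P fun i => (ts i).subst (Function.update FirstOrder.Language.Term.var x t)
  | and φ ψ => and (φ.subst x t) (ψ.subst x t)
  | or φ ψ => or (φ.subst x t) (ψ.subst x t)
  | imp φ ψ => imp (φ.subst x t) (ψ.subst x t)
  | neg φ => neg (φ.subst x t)
  | cons φ => cons (φ.subst x t)
  | all y φ => if y = x then all y φ else all y (φ.subst x t)

/-- The term `t` is free for `x` in a formula: no free occurrence of `x` lies in the scope of a
quantifier that binds a variable of `t`. -/
def FreeFor (x : ℕ) (t : L.Term ℕ) : UFormula L → Prop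
  | rel _ _ => True
  | and φ ψ => φ.FreeFor x t ∧ ψ.FreeFor x t
  | or φ ψ => φ.FreeFor x t ∧ ψ.FreeFor x t
  | imp φ ψ => φ.FreeFor x t ∧ ψ.FreeFor x t
  | neg φ => φ.FreeFor x t
  | cons φ => φ.FreeFor x t
  | all y φ => x ∉ (all y φ).freeVars ∨ (y ∉ t.varFinset ∧ φ.FreeFor x t)

end UFormula

/-- Reading `∃x φ` as the abbreviation of `¬∀x¬φ`. -/
def Formula.unfoldEx {L : FirstOrder.Language.{u, v}} : Formula L → UFormula L
  | .rel P ts => .rel P ts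
  | .and φ ψ => .and φ.unfoldEx ψ.unfoldEx
  | .or φ ψ => .or φ.unfoldEx ψ.unfoldEx
  | .imp φ ψ => .imp φ.unfoldEx ψ.unfoldEx
  | .neg φ => .neg φ.unfoldEx
  | .cons φ => .cons φ.unfoldEx
  | .all x φ => .all x φ.unfoldEx
  | .ex x φ => .neg (.all x (.neg φ.unfoldEx))

/-! ### Semantics -/

/-- A `4`-structure (partial structure) over the signature `L`. -/
structure FourStructure (L : FirstOrder.Language.{u, v}) : Type (max u v (w + 1)) where
  Carrier : Type w
  nonempty : Nonempty Carrier
  relMap : ∀ {k : ℕ}, L.Relations k → (Fin k → Carrier) → Four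
  funMap : ∀ {k : ℕ}, L.Functions k → (Fin k → Carrier) → Carrier

namespace FourStructure

variable {L : FirstOrder.Language.{u, v}} (A : FourStructure.{u, v, w} L)

/-- The value of a term under the assignment `s`. -/
def termVal (s : ℕ → A.Carrier) : L.Term ℕ → A.Carrier
  | .var x => s x
  | .func f ts => A.funMap f fun i => termVal s (ts i)

/-- The value of a formula under the assignment `s`. -/
noncomputable def val : Formula L → (ℕ → A.Carrier) → Four
  | .rel P ts, s => A.relMap P fun i => A.termVal s (ts i)
  | .and φ ψ, s => (val φ s).and (val ψ s)
  | .or φ ψ, s => (val φ s).or (val ψ s)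
  | .imp φ ψ, s => (val φ s).imp (val ψ s)
  | .neg φ, s => (val φ s).neg
  | .cons φ, s => (val φ s).cons
  | .all x φ, s => ⨅ a : A.Carrier, val φ (Function.update s x a)
  | .ex x φ, s => ⨆ a : A.Carrier, val φ (Function.update s x a)

/-- `A` is a model of `φ` if every assignment gives `φ` a designated value. -/
def IsModel (φ : Formula L) : Prop :=
  ∀ s : ℕ → A.Carrier, A.val φ s ∈ Four.designated

end FourStructure

/-- Semantic consequence of QBD2: every model of `Δ` is a model of `φ`. -/
def Consequence {L : FirstOrder.Language.{u, v}} (Δ : Set (Formula L)) (φ : Formula L) : Prop :=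
  ∀ A : FourStructure.{u, v, w} L, (∀ δ ∈ Δ, A.IsModel δ) → A.IsModel φ

/-! ### The Hilbert calculus HQBD2 -/

/-- The axioms of HQBD2. -/
inductive HilbertAx {L : FirstOrder.Language.{u, v}} : UFormula L → Prop
  | pos1 (α β : UFormula L) : HilbertAx (α.imp (β.imp α))
  | pos2 (α β γ : UFormula L) :
      HilbertAx ((α.imp (β.imp γ)).imp ((α.imp β).imp (α.imp γ)))
  | pos3 (α β : UFormula L) : HilbertAx ((α.and β).imp α)
  | pos4 (α β : UFormula L) : HilbertAx ((α.and β).imp β)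
  | pos5 (α β : UFormula L) : HilbertAx (α.imp (β.imp (α.and β)))
  | pos6 (α β : UFormula L) : HilbertAx (α.imp (α.or β))
  | pos7 (α β : UFormula L) : HilbertAx (α.imp (β.or α))
  | pos8 (α β γ : UFormula L) :
      HilbertAx ((α.imp γ).imp ((β.imp γ).imp ((α.or β).imp γ)))
  | pos9 (α β : UFormula L) : HilbertAx (α.or (α.imp β))
  | dneg (α : UFormula L) : HilbertAx (α.neg.neg.iff α)
  | dm1 (α β : UFormula L) : HilbertAx ((α.or β).neg.iff (α.neg.and β.neg))
  | dm2 (α β : UFormula L) : HilbertAx ((α.and β).neg.iff (α.neg.or β.neg))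
  | dm3 (α β : UFormula L) : HilbertAx ((α.imp β).neg.iff ((α.neg.imp α).and β.neg))
  | cons1 (α β : UFormula L) : HilbertAx ((α.cons.and (α.and α.neg)).imp β)
  | cons2 (α : UFormula L) : HilbertAx (α.cons.or (α.and α.neg))
  | cons3 (α : UFormula L) : HilbertAx (α.cons.neg.iff (α.iff α.neg))
  | allA (x : ℕ) (t : L.Term ℕ) (φ : UFormula L) (h : φ.FreeFor x t) :
      HilbertAx ((φ.all x).imp (φ.subst x t))
  | allB (x : ℕ) (φ : UFormula L) : HilbertAx ((φ.all x).neg.imp (φ.neg.neg.all x).neg)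
  | allC (x : ℕ) (t : L.Term ℕ) (φ : UFormula L) (h : φ.FreeFor x t) :
      HilbertAx ((φ.subst x t).neg.imp (φ.all x).neg)

/-- Derivability in HQBD2 from a set of formulas. -/
inductive Derivable {L : FirstOrder.Language.{u, v}} (Γ : Set (UFormula L)) : UFormula L → Prop
  | hyp {φ : UFormula L} (h : φ ∈ Γ) : Derivable Γ φ
  | ax {φ : UFormula L} (h : HilbertAx φ) : Derivable Γ φ
  | mp {φ ψ : UFormula L} (h₁ : Derivable Γ (φ.imp ψ)) (h₂ : Derivable Γ φ) : Derivable Γ ψ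
  | allIn1 {α β : UFormula L} (x : ℕ) (hx : x ∉ α.freeVars) (h : Derivable Γ (α.imp β)) :
      Derivable Γ (α.imp (β.all x))
  | allIn2 {α β : UFormula L} (x : ℕ) (hx : x ∉ α.freeVars) (h : Derivable Γ (β.imp α)) :
      Derivable Γ ((β.neg.all x).neg.imp α)

end QBD2

-- A value x of 4 is determined by two bits: whether x is designated and whether ¬x is. On these
-- bits every connective acts as a classical truth function, and infima and suprema act as classical
-- quantifiers. Soundness is then checked axiom by axiom. Moreover ∃ has the same value as ¬∀¬
-- (`val_unfoldEx`), which reduces the second equivalence to the first.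
--
-- For completeness, universal closure turns all formulas into sentences without affecting models or
-- derivability. By the two bits, a 4-structure amounts to a classical structure with two relations
-- per relation symbol, so classical compactness (`exists_structure_of_finite`) leaves only finite
-- sets of premises. This disposes of large signatures: finitely many sentences involve countably
-- many function symbols, and their bound variables lie below some N. Ordinary variables can
-- therefore serve as Henkin witnesses, and the signature is not extended.
--
-- The negation ¬ is neither explosive nor exhaustive, but the sentence ⊥ = ©φ ∧ (φ ∧ ¬φ) implies
-- everything, and α ∨ (α → ⊥) makes α → ⊥ a classical negation. If φ is underivable, φ → ⊥ is
-- consistent, and a Rasiowa–Sikorski argument (`exists_generic`, `exists_isHenkin`) extends it to a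
-- theory that decides the relevant countably many formulas. It has witnesses both when ∀xψ is not
-- in it and when ¬∀xψ is; these are separate conditions, one for each bit. The truth lemma
-- `des_val_termModel`, proved for both bits at once, shows that the term model refutes φ.

universe w'

namespace QBD2

/-! ### Designated values -/

namespace Four

/-- A value is designated if it is `1` or `b`. -/
def Des (x : Four) : Prop := x ∈ designated

instance (x : Four) : Decidable x.Des :=
  decidable_of_iff (x = one ∨ x = b) Iff.rfl

theorem des_and (x y : Four) : (x.and y).Des ↔ x.Des ∧ y.Des := by
  revert x y; decide

theorem des_or (x y : Four) : (x.or y).Des ↔ x.Des ∨ y.Des := by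
  revert x y; decide

theorem des_imp (x y : Four) : (x.imp y).Des ↔ (x.Des → y.Des) := by
  revert x y; decide

theorem des_cons (x : Four) : x.cons.Des ↔ ¬(x.Des ∧ x.neg.Des) := by
  revert x; decide

theorem neg_neg (x : Four) : x.neg.neg = x := by
  revert x; decide

theorem des_neg_and (x y : Four) : (x.and y).neg.Des ↔ x.neg.Des ∨ y.neg.Des := by
  revert x y; decide

theorem des_neg_or (x y : Four) : (x.or y).neg.Des ↔ x.neg.Des ∧ y.neg.Des := by
  revert x y; decide

theorem des_neg_imp (x y : Four) :
    (x.imp y).neg.Des ↔ (x.neg.Des → x.Des) ∧ y.neg.Des := by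
  revert x y; decide

theorem des_neg_cons (x : Four) : x.cons.neg.Des ↔ (x.Des ↔ x.neg.Des) := by
  revert x; decide

theorem ext_des {x y : Four} (h₁ : x.Des ↔ y.Des) (h₂ : x.neg.Des ↔ y.neg.Des) : x = y := by
  revert x y; decide

/-- The set {1, b} is both the up-set of b and the complement of the down-set of n; dually for the
values with designated negation. In these forms the universal properties of infimum and supremum
give the quantifier clauses, over an index set of any size. -/
theorem des_iff_le (x : Four) : x.Des ↔ b ≤ x := by
  revert x; decide

theorem des_neg_iff_not_le (x : Four) : x.neg.Des ↔ ¬ n ≤ x := by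
  revert x; decide

theorem des_iff_not_le (x : Four) : x.Des ↔ ¬ x ≤ n := by
  revert x; decide

theorem des_neg_iff_le (x : Four) : x.neg.Des ↔ x ≤ b := by
  revert x; decide

variable {ι : Sort*} (f : ι → Four)

theorem des_iInf : (⨅ i, f i).Des ↔ ∀ i, (f i).Des := by
  simp only [des_iff_le]
  exact le_iInf_iff

theorem des_neg_iInf : (⨅ i, f i).neg.Des ↔ ∃ i, (f i).neg.Des := by
  simp only [des_neg_iff_not_le, ← not_forall]
  exact not_congr le_iInf_iff

theorem des_iSup : (⨆ i, f i).Des ↔ ∃ i, (f i).Des := by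
  simp only [des_iff_not_le, ← not_forall]
  exact not_congr iSup_le_iff

theorem des_neg_iSup : (⨆ i, f i).neg.Des ↔ ∀ i, (f i).neg.Des := by
  simp only [des_neg_iff_le]
  exact iSup_le_iff

/-- The value that is designated iff `p` holds and whose negation is designated iff `q` holds. -/
noncomputable def ofProps (p q : Prop) : Four :=
  open Classical in if p then (if q then b else one) else (if q then zero else n)

theorem des_ofProps (p q : Prop) : (ofProps p q).Des ↔ p := by
  by_cases hp : p <;> by_cases hq : q <;> simp only [ofProps, hp, hq, if_true, if_false] <;> decide

theorem des_neg_ofProps (p q : Prop) : (ofProps p q).neg.Des ↔ q := by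
  by_cases hp : p <;> by_cases hq : q <;> simp only [ofProps, hp, hq, if_true, if_false] <;> decide

end Four

/-! ### Free variables and substitution -/

namespace UFormula

variable {L : FirstOrder.Language.{u, v}}

theorem freeFor_of_notMem {x : ℕ} {t : L.Term ℕ} (φ : UFormula L) (h : x ∉ φ.freeVars) :
    φ.FreeFor x t := by
  induction φ with
  | rel P ts => trivial
  | and φ ψ ih₁ ih₂ | or φ ψ ih₁ ih₂ | imp φ ψ ih₁ ih₂ =>
    exact ⟨ih₁ fun hx => h (Finset.mem_union_left _ hx),
      ih₂ fun hx => h (Finset.mem_union_right _ hx)⟩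
  | neg φ ih | cons φ ih => exact ih h
  | all y φ ih => exact Or.inl h

theorem freeFor_var_self (x : ℕ) (φ : UFormula L) : φ.FreeFor x (.var x) := by
  induction φ with
  | rel P ts => trivial
  | and φ ψ ih₁ ih₂ | or φ ψ ih₁ ih₂ | imp φ ψ ih₁ ih₂ => exact ⟨ih₁, ih₂⟩
  | neg φ ih | cons φ ih => exact ih
  | all y φ ih =>
    by_cases hy : y = x
    · exact Or.inl (by simp [freeVars, hy])
    · exact Or.inr ⟨by simpa using hy, ih⟩

theorem term_subst_var (t : L.Term ℕ) : t.subst FirstOrder.Language.Term.var = t := by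
  induction t with
  | var x => rfl
  | func f ts ih => simp [ih]

theorem subst_var_self (x : ℕ) (φ : UFormula L) : φ.subst x (.var x) = φ := by
  induction φ with
  | rel P ts => simp [subst, term_subst_var]
  | and φ ψ ih₁ ih₂ | or φ ψ ih₁ ih₂ | imp φ ψ ih₁ ih₂ => simp [subst, ih₁, ih₂]
  | neg φ ih | cons φ ih => simp [subst, ih]
  | all y φ ih => simp [subst, ih]

end UFormula

/-! ### Values of formulas -/

namespace FourStructure

variable {L : FirstOrder.Language.{u, v}} (A : FourStructure.{u, v, w} L)

theorem isModel_iff (φ : Formula L) : A.IsModel φ ↔ ∀ s, (A.val φ s).Des := Iff.rfl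

theorem termVal_congr {s s' : ℕ → A.Carrier} (t : L.Term ℕ)
    (h : ∀ x ∈ t.varFinset, s x = s' x) : A.termVal s t = A.termVal s' t := by
  induction t with
  | var x => exact h x (by simp)
  | func f ts ih =>
    simp only [termVal]
    congr 1
    funext i
    exact ih i fun x hx => h x (by simpa using ⟨i, hx⟩)

theorem termVal_subst (s : ℕ → A.Carrier) (σ : ℕ → L.Term ℕ) (t : L.Term ℕ) :
    A.termVal s (t.subst σ) = A.termVal (fun x => A.termVal s (σ x)) t := by
  induction t with
  | var x => rfl
  | func f ts ih => simp only [FirstOrder.Language.Term.subst, termVal, ih]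

theorem val_congr (φ : UFormula L) {s s' : ℕ → A.Carrier} (h : ∀ x ∈ φ.freeVars, s x = s' x) :
    A.val φ.toFormula s = A.val φ.toFormula s' := by
  induction φ generalizing s s' with
  | rel P ts =>
    simp only [UFormula.toFormula, val]
    congr 1
    funext i
    exact A.termVal_congr _ fun x hx => h x (by simpa [UFormula.freeVars] using ⟨i, hx⟩)
  | and φ ψ ih₁ ih₂ | or φ ψ ih₁ ih₂ | imp φ ψ ih₁ ih₂ =>
    simp only [UFormula.toFormula, val]
    rw [ih₁ fun x hx => h x (Finset.mem_union_left _ hx),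
      ih₂ fun x hx => h x (Finset.mem_union_right _ hx)]
  | neg φ ih | cons φ ih =>
    simp only [UFormula.toFormula, val]
    rw [ih h]
  | all x φ ih =>
    simp only [UFormula.toFormula, val]
    congr 1
    funext a
    refine ih fun y hy => ?_
    by_cases hyx : y = x
    · simp [hyx]
    · simpa [hyx] using h y (Finset.mem_erase.2 ⟨hyx, hy⟩)

theorem val_subst (x : ℕ) (t : L.Term ℕ) (φ : UFormula L) (h : φ.FreeFor x t)
    (s : ℕ → A.Carrier) :
    A.val (φ.subst x t).toFormula s =
      A.val φ.toFormula (Function.update s x (A.termVal s t)) := by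
  induction φ generalizing s with
  | rel P ts =>
    simp only [UFormula.subst, UFormula.toFormula, val, termVal_subst]
    congr 1
    funext i
    congr 1
    funext y
    by_cases hy : y = x
    · subst hy; simp
    · simp [hy, termVal]
  | and φ ψ ih₁ ih₂ | or φ ψ ih₁ ih₂ | imp φ ψ ih₁ ih₂ =>
    simp only [UFormula.subst, UFormula.toFormula, val, ih₁ h.1, ih₂ h.2]
  | neg φ ih | cons φ ih =>
    simp only [UFormula.subst, UFormula.toFormula, val, ih h]
  | all y φ ih =>
    by_cases hyx : y = x
    · subst hyx
      simp [UFormula.subst, UFormula.toFormula, val]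
    · simp only [UFormula.subst, hyx, if_false, UFormula.toFormula, val]
      congr 1
      funext a
      -- Either x is not free in φ, and its value is irrelevant, or y does not occur in t, and the
      -- value of t survives the change at y.
      rcases h with hx | ⟨hy, hφ⟩
      · have hx' : x ∉ φ.freeVars := fun hx' =>
          hx (Finset.mem_erase.2 ⟨fun e => hyx e.symm, hx'⟩)
        rw [ih (φ.freeFor_of_notMem hx')]
        refine A.val_congr φ fun z hz => ?_
        have hzx : z ≠ x := fun e => hx' (e ▸ hz)
        by_cases hzy : z = y <;> simp [hzx, hzy, hyx]
      · rw [ih hφ, Function.update_comm hyx]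
        rw [A.termVal_congr (s := Function.update s y a) (s' := s) t]
        intro z hz
        exact Function.update_of_ne (ne_of_mem_of_not_mem hz hy) _ _

theorem val_unfoldEx (φ : Formula L) (s : ℕ → A.Carrier) :
    A.val φ.unfoldEx.toFormula s = A.val φ s := by
  induction φ generalizing s with
  | rel P ts => rfl
  | and φ ψ ih₁ ih₂ | or φ ψ ih₁ ih₂ | imp φ ψ ih₁ ih₂ =>
    simp only [Formula.unfoldEx, UFormula.toFormula, val, ih₁, ih₂]
  | neg φ ih | cons φ ih | all x φ ih =>
    simp only [Formula.unfoldEx, UFormula.toFormula, val, ih]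
  | ex x φ ih =>
    simp only [Formula.unfoldEx, UFormula.toFormula, val, ih]
    apply Four.ext_des
    · simp only [Four.des_neg_iInf, Four.neg_neg, Four.des_iSup]
    · simp only [Four.neg_neg, Four.des_iInf, Four.des_neg_iSup]

theorem isModel_unfoldEx (φ : Formula L) : A.IsModel φ.unfoldEx.toFormula ↔ A.IsModel φ := by
  simp only [isModel_iff, val_unfoldEx]

/-! ### Soundness -/

theorem des_val_of_hilbertAx {φ : UFormula L} (h : HilbertAx φ) (s : ℕ → A.Carrier) :
    (A.val φ.toFormula s).Des := by
  cases h with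
  | allA x t φ h =>
    simp only [UFormula.toFormula, val, Four.des_imp, Four.des_iInf, A.val_subst x t φ h]
    exact fun H => H _
  | allB x φ =>
    simp only [UFormula.toFormula, val, Four.des_imp, Four.neg_neg, imp_self]
  | allC x t φ h =>
    simp only [UFormula.toFormula, val, Four.des_imp, Four.des_neg_iInf, A.val_subst x t φ h]
    exact fun H => ⟨_, H⟩
  | _ =>
    -- In terms of the two bits, each remaining axiom becomes a classical tautology.
    simp only [UFormula.toFormula, UFormula.iff, val, Four.des_imp, Four.des_and, Four.des_or,
      Four.des_cons, Four.neg_neg, Four.des_neg_and, Four.des_neg_or, Four.des_neg_imp,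
      Four.des_neg_cons]
    grind

theorem isModel_of_derivable {Δ : Set (UFormula L)} {φ : UFormula L} (h : Derivable Δ φ)
    (hA : ∀ δ ∈ Δ, A.IsModel δ.toFormula) : A.IsModel φ.toFormula := by
  simp only [isModel_iff] at hA ⊢
  induction h with
  | hyp h => exact hA _ h
  | ax h => exact A.des_val_of_hilbertAx h
  | mp _ _ ih₁ ih₂ => exact fun s => (Four.des_imp _ _).1 (ih₁ s) (ih₂ s)
  | @allIn1 α β x hx _ ih =>
    intro s
    simp only [UFormula.toFormula, val, Four.des_imp, Four.des_iInf] at ih ⊢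
    intro hα a
    refine ih _ ?_
    rwa [A.val_congr α (s' := s)]
    exact fun y hy => Function.update_of_ne (ne_of_mem_of_not_mem hy hx) _ _
  | @allIn2 α β x hx _ ih =>
    intro s
    simp only [UFormula.toFormula, val, Four.des_imp, Four.des_neg_iInf, Four.neg_neg] at ih ⊢
    rintro ⟨a, ha⟩
    rw [← A.val_congr α (s := Function.update s x a)]
    · exact ih _ ha
    · exact fun y hy => Function.update_of_ne (ne_of_mem_of_not_mem hy hx) _ _

end FourStructure

/-! ### Basic derivations -/

namespace Derivable

variable {L : FirstOrder.Language.{u, v}} {Δ : Set (UFormula L)} {α β γ δ : UFormula L}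

theorem trans_hyp {Δ' : Set (UFormula L)} (h : Derivable Δ α) (hΔ : ∀ δ ∈ Δ, Derivable Δ' δ) :
    Derivable Δ' α := by
  induction h with
  | hyp h => exact hΔ _ h
  | ax h => exact ax h
  | mp _ _ ih₁ ih₂ => exact mp ih₁ ih₂
  | allIn1 x hx _ ih => exact allIn1 x hx ih
  | allIn2 x hx _ ih => exact allIn2 x hx ih

theorem weaken (h : Derivable Δ α) : Derivable Δ (γ.imp α) := mp (ax (.pos1 _ _)) h

theorem imp_mp (h₁ : Derivable Δ (γ.imp (α.imp β))) (h₂ : Derivable Δ (γ.imp α)) :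
    Derivable Δ (γ.imp β) := mp (mp (ax (.pos2 _ _ _)) h₁) h₂

theorem imp_refl : Derivable Δ (α.imp α) :=
  imp_mp (β := α) (α := α.imp α) (ax (.pos1 _ _)) (ax (.pos1 _ _))

theorem imp_trans (h₁ : Derivable Δ (α.imp β)) (h₂ : Derivable Δ (β.imp γ)) :
    Derivable Δ (α.imp γ) := imp_mp h₂.weaken h₁

theorem imp_and (h₁ : Derivable Δ (γ.imp α)) (h₂ : Derivable Δ (γ.imp β)) :
    Derivable Δ (γ.imp (α.and β)) := imp_mp (imp_mp (ax (.pos5 _ _)).weaken h₁) h₂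

theorem curry (h : Derivable Δ ((α.and β).imp γ)) : Derivable Δ (α.imp (β.imp γ)) :=
  imp_trans (ax (.pos5 _ _)) (mp (ax (.pos2 _ _ _)) h.weaken)

theorem uncurry (h : Derivable Δ (α.imp (β.imp γ))) : Derivable Δ ((α.and β).imp γ) :=
  imp_mp (imp_trans (ax (.pos3 _ _)) h) (ax (.pos4 _ _))

theorem swap (h : Derivable Δ (α.imp (β.imp γ))) : Derivable Δ (β.imp (α.imp γ)) :=
  curry (imp_trans (imp_and (ax (.pos4 _ _)) (ax (.pos3 _ _))) (uncurry h))

theorem imp_cases (h₁ : Derivable Δ (α.imp γ)) (h₂ : Derivable Δ (β.imp γ)) :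
    Derivable Δ ((α.or β).imp γ) := mp (mp (ax (.pos8 _ _ _)) h₁) h₂

/-- Double negation elimination relative to an explosive formula `δ`. -/
theorem imp_of_imp_imp (hδ : Derivable Δ (δ.imp α))
    (h : Derivable Δ (γ.imp ((α.imp δ).imp δ))) : Derivable Δ (γ.imp α) := by
  have h₁ : Derivable Δ ((α.imp δ).imp (γ.imp α)) :=
    imp_trans (swap h) (mp (ax (.pos2 _ _ _)) hδ.weaken)
  -- Case distinction on the axiom α ∨ (α → δ).
  exact mp (imp_cases (ax (.pos1 _ _)) h₁) (ax (.pos9 _ _))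

theorem generalize (x : ℕ) (h : Derivable Δ α) : Derivable Δ (α.all x) := by
  -- The rule needs an antecedent without x free; any provable one will do.
  have hx : x ∉ ((α.all x).imp (α.all x)).freeVars := by simp [UFormula.freeVars]
  exact mp (allIn1 x hx h.weaken) imp_refl

theorem of_all {x : ℕ} (h : Derivable Δ (α.all x)) : Derivable Δ α := by
  have := mp (ax (.allA x (.var x) α (α.freeFor_var_self x))) h
  rwa [α.subst_var_self] at this

/-- The second quantifier rule, applied to ¬β, has the premise ¬¬∀-free form ¬β → α but concludes
from ¬∀x¬¬β; the axiom `allB` bridges the gap from ¬∀xβ. -/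
theorem neg_all_imp {x : ℕ} (hx : x ∉ α.freeVars) (h : Derivable Δ (β.neg.imp α)) :
    Derivable Δ ((β.all x).neg.imp α) :=
  imp_trans (ax (.allB x β)) (allIn2 x hx h)

end Derivable

/-! ### Universal closure -/

namespace UFormula

variable {L : FirstOrder.Language.{u, v}}

/-- Universal quantification over the variables `0, …, m - 1`. -/
def allBelow (φ : UFormula L) : ℕ → UFormula L
  | 0 => φ
  | m + 1 => (φ.allBelow m).all m

/-- The universal closure of a formula. -/
def close (φ : UFormula L) : UFormula L := φ.allBelow (φ.freeVars.sup Nat.succ)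

theorem freeVars_allBelow (φ : UFormula L) (m : ℕ) :
    (φ.allBelow m).freeVars = φ.freeVars.filter (m ≤ ·) := by
  induction m with
  | zero => simp [allBelow]
  | succ m ih =>
    ext x
    simp only [allBelow, freeVars, ih, Finset.mem_erase, Finset.mem_filter]
    constructor
    · rintro ⟨h₁, h₂, h₃⟩
      exact ⟨h₂, by omega⟩
    · rintro ⟨h₁, h₂⟩
      exact ⟨by omega, h₁, by omega⟩

theorem freeVars_close (φ : UFormula L) : φ.close.freeVars = ∅ := by
  rw [close, freeVars_allBelow, Finset.filter_eq_empty_iff]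
  intro x hx
  have : x + 1 ≤ φ.freeVars.sup Nat.succ := Finset.le_sup (f := Nat.succ) hx
  omega

/-- Premises are read as valid under all assignments, so generalization is unrestricted; conversely
∀x is removed by instantiating x with itself. -/
theorem derivable_close_iff {Δ : Set (UFormula L)} (φ : UFormula L) :
    Derivable Δ φ.close ↔ Derivable Δ φ := by
  rw [close]
  induction φ.freeVars.sup Nat.succ with
  | zero => rfl
  | succ m ih => exact ⟨fun h => ih.1 h.of_all, fun h => (ih.2 h).generalize m⟩

end UFormula

theorem FourStructure.isModel_close_iff {L : FirstOrder.Language.{u, v}}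
    (A : FourStructure.{u, v, w} L) (φ : UFormula L) :
    A.IsModel φ.close.toFormula ↔ A.IsModel φ.toFormula := by
  rw [UFormula.close]
  induction φ.freeVars.sup Nat.succ with
  | zero => rfl
  | succ m ih =>
    rw [← ih]
    simp only [isModel_iff, UFormula.allBelow, UFormula.toFormula, val, Four.des_iInf]
    refine ⟨fun h s => ?_, fun h s a => h _⟩
    simpa using h s (s m)

open scoped FirstOrder

/-! ### Compactness

A `4`-structure is coded by a classical structure with two relations for each relation symbol,
which say where the symbol and its negation are designated. -/

/-- The language with two copies of each relation symbol. -/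
def doubled (L : FirstOrder.Language.{u, v}) : FirstOrder.Language.{u, v} :=
  ⟨L.Functions, fun k => L.Relations k × Bool⟩

/-- Terms of `L` as terms of the doubled language. -/
def doubledTerm {L : FirstOrder.Language.{u, v}} : L.Term ℕ → (doubled L).Term ℕ
  | .var x => .var x
  | .func (l := k) f ts => .func (L := doubled L) (l := k) f fun i => doubledTerm (ts i)

/-- Quantification over a named free variable of a classical formula. -/
noncomputable def allVar {L : FirstOrder.Language.{u, v}} (x : ℕ) (φ : L.Formula ℕ) :
    L.Formula ℕ :=
  FirstOrder.Language.Formula.iAlls Unit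
    (φ.relabel fun y => if y = x then Sum.inr () else Sum.inl y)

theorem realize_allVar {L : FirstOrder.Language.{u, v}} {M : Type w} [L.Structure M] (x : ℕ)
    (φ : L.Formula ℕ) (s : ℕ → M) :
    (allVar x φ).Realize s ↔ ∀ a, φ.Realize (Function.update s x a) := by
  have key : ∀ i : Unit → M,
      (Sum.elim s i ∘ fun y => if y = x then Sum.inr () else Sum.inl y) =
        Function.update s x (i ()) := by
    intro i
    funext y
    by_cases hy : y = x
    · subst hy; simp
    · simp [hy]
  simp only [allVar, FirstOrder.Language.Formula.realize_iAlls,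
    FirstOrder.Language.Formula.realize_relabel]
  constructor
  · intro h a
    have := h fun _ => a
    rwa [key] at this
  · intro h i
    rw [key]
    exact h _

/-- The classical formula which says that the given formula (for `true`) or its negation
(for `false`) is designated. -/
noncomputable def UFormula.classical {L : FirstOrder.Language.{u, v}} :
    UFormula L → Bool → (doubled L).Formula ℕ
  | rel (k := k) P ts, c =>
      FirstOrder.Language.Relations.formula (L := doubled L) (n := k) (P, c)
        fun i => doubledTerm (ts i)
  | and φ ψ, true => φ.classical true ⊓ ψ.classical true
  | and φ ψ, false => φ.classical false ⊔ ψ.classical false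
  | or φ ψ, true => φ.classical true ⊔ ψ.classical true
  | or φ ψ, false => φ.classical false ⊓ ψ.classical false
  | imp φ ψ, true => (φ.classical true).imp (ψ.classical true)
  | imp φ ψ, false => (φ.classical false).imp (φ.classical true) ⊓ ψ.classical false
  | neg φ, c => φ.classical !c
  | cons φ, true => (φ.classical true ⊓ φ.classical false).not
  | cons φ, false => (φ.classical true).iff (φ.classical false)
  | all x φ, true => allVar x (φ.classical true)
  | all x φ, false => (allVar x (φ.classical false).not).not

namespace FourStructure

variable {L : FirstOrder.Language.{u, v}}

/-- The classical structure that codes a `4`-structure. -/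
abbrev classical (A : FourStructure.{u, v, w} L) : (doubled L).Structure A.Carrier where
  funMap {k} f v := A.funMap (k := k) f v
  RelMap {k} (P : L.Relations k × Bool) v :=
    if P.2 then (A.relMap P.1 v).Des else (A.relMap P.1 v).neg.Des

/-- The `4`-structure coded by a classical structure. -/
noncomputable def ofClassical (M : Type w) [Nonempty M] [(doubled L).Structure M] :
    FourStructure.{u, v, w} L where
  Carrier := M
  nonempty := inferInstance
  relMap {k} P v := Four.ofProps
    (FirstOrder.Language.Structure.RelMap (L := doubled L) (n := k) (P, true) v)
    (FirstOrder.Language.Structure.RelMap (L := doubled L) (n := k) (P, false) v)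
  funMap {k} f v := FirstOrder.Language.Structure.funMap (L := doubled L) (n := k) f v

/-- A classical structure on the carrier codes the `4`-structure. -/
structure Codes (A : FourStructure.{u, v, w} L) [S : (doubled L).Structure A.Carrier] : Prop where
  funMap_eq : ∀ {k : ℕ} (f : L.Functions k) (v : Fin k → A.Carrier),
    S.funMap (n := k) f v = A.funMap f v
  relMap_true : ∀ {k : ℕ} (P : L.Relations k) (v : Fin k → A.Carrier),
    S.RelMap (n := k) (P, true) v ↔ (A.relMap P v).Des
  relMap_false : ∀ {k : ℕ} (P : L.Relations k) (v : Fin k → A.Carrier),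
    S.RelMap (n := k) (P, false) v ↔ (A.relMap P v).neg.Des

variable {A : FourStructure.{u, v, w} L} [(doubled L).Structure A.Carrier]

theorem Codes.realize_term (h : A.Codes) (t : L.Term ℕ) (s : ℕ → A.Carrier) :
    (doubledTerm t).realize s = A.termVal s t := by
  induction t with
  | var x => rfl
  | func f ts ih =>
    simp only [doubledTerm, FirstOrder.Language.Term.realize, ih, termVal]
    exact h.funMap_eq f _

theorem Codes.realize_classical (h : A.Codes) (φ : UFormula L) (s : ℕ → A.Carrier) :
    ((φ.classical true).Realize s ↔ (A.val φ.toFormula s).Des) ∧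
      ((φ.classical false).Realize s ↔ (A.val φ.toFormula s).neg.Des) := by
  induction φ generalizing s with
  | rel P ts =>
    have e : (fun i => (doubledTerm (ts i)).realize s) = fun i => A.termVal s (ts i) :=
      funext fun i => h.realize_term (ts i) s
    refine ⟨Iff.trans FirstOrder.Language.Formula.realize_rel ?_,
      Iff.trans FirstOrder.Language.Formula.realize_rel ?_⟩ <;> rw [e]
    exacts [h.relMap_true P _, h.relMap_false P _]
  | and φ ψ ih₁ ih₂ | or φ ψ ih₁ ih₂ | imp φ ψ ih₁ ih₂ =>
    simp [UFormula.classical, UFormula.toFormula, val, ih₁, ih₂, Four.des_and, Four.des_or,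
      Four.des_imp, Four.des_neg_and, Four.des_neg_or, Four.des_neg_imp]
  | neg φ ih =>
    simp [UFormula.classical, UFormula.toFormula, val, ih, Four.neg_neg]
  | cons φ ih =>
    simp [UFormula.classical, UFormula.toFormula, val, ih, Four.des_cons, Four.des_neg_cons]
  | all x φ ih =>
    simp [UFormula.classical, UFormula.toFormula, val, ih, Four.des_iInf, Four.des_neg_iInf,
      realize_allVar]

theorem codes_classical (A : FourStructure.{u, v, w} L) : letI := A.classical; A.Codes :=
  letI := A.classical
  { funMap_eq := fun _ _ => rfl
    relMap_true := fun P v => by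
      change (if true = true then _ else _) ↔ _
      simp
    relMap_false := fun P v => by
      change (if false = true then _ else _) ↔ _
      simp }

instance (M : Type w) [Nonempty M] [S : (doubled L).Structure M] :
    (doubled L).Structure (ofClassical (L := L) M).Carrier := S

theorem codes_ofClassical (M : Type w) [Nonempty M] [(doubled L).Structure M] :
    (ofClassical (L := L) M).Codes :=
  { funMap_eq := fun _ _ => rfl
    relMap_true := fun _ _ => (Four.des_ofProps _ _).symm
    relMap_false := fun _ _ => (Four.des_neg_ofProps _ _).symm }

end FourStructure

/-- Compactness for sets of formulas satisfied at an assignment, where in addition one formula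
is required not to be designated. -/
theorem exists_structure_of_finite {L : FirstOrder.Language.{u, v}} (Δ : Set (UFormula L))
    (φ : UFormula L)
    (h : ∀ Δ₀ : Set (UFormula L), Δ₀ ⊆ Δ → Δ₀.Finite →
      ∃ (A : FourStructure.{u, v, w'} L) (s : ℕ → A.Carrier),
        (∀ δ ∈ Δ₀, (A.val δ.toFormula s).Des) ∧ ¬(A.val φ.toFormula s).Des) :
    ∃ (A : FourStructure.{u, v, max u v w} L) (s : ℕ → A.Carrier),
      (∀ δ ∈ Δ, (A.val δ.toFormula s).Des) ∧ ¬(A.val φ.toFormula s).Des := by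
  -- Variables become constants, so that an assignment is part of the structure.
  let f : UFormula L → (doubled L)[[ℕ]].Sentence := fun δ =>
    FirstOrder.Language.Formula.equivSentence (δ.classical true)
  let T : (doubled L)[[ℕ]].Theory :=
    insert (FirstOrder.Language.Formula.equivSentence (φ.classical true).not) (f '' Δ)
  have hT : T.IsSatisfiable := by
    rw [FirstOrder.Language.Theory.isSatisfiable_iff_isFinitelySatisfiable]
    intro T₀ hT₀
    obtain ⟨Δ₀, hΔ₀, hfin, hsub⟩ : ∃ Δ₀ ⊆ Δ, Δ₀.Finite ∧
        (T₀ : Set _) ⊆ insert (FirstOrder.Language.Formula.equivSentence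
          (φ.classical true).not) (f '' Δ₀) := by
      -- One preimage is chosen for each sentence of `T₀`, which keeps `Δ₀` finite without
      -- injectivity of `f`.
      obtain ⟨Δ₀, h₁, h₂⟩ := Set.exists_subset_bijOn (Δ ∩ f ⁻¹' T₀) f
      refine ⟨Δ₀, h₁.trans Set.inter_subset_left, ?_, ?_⟩
      · exact Set.Finite.of_finite_image ((T₀.finite_toSet).subset
          (by rintro _ ⟨δ, hδ, rfl⟩; exact (h₁ hδ).2)) h₂.injOn
      · intro θ hθ
        rcases hT₀ hθ with rfl | ⟨δ, hδ, rfl⟩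
        · exact Or.inl rfl
        · right
          rw [h₂.image_eq]
          exact ⟨δ, ⟨hδ, hθ⟩, rfl⟩
    obtain ⟨A, s, h₁, h₂⟩ := h Δ₀ hΔ₀ hfin
    let := A.classical
    let := FirstOrder.Language.constantsOn.structure s
    have := A.nonempty
    have hr : ∀ θ : (doubled L).Formula ℕ,
        A.Carrier ⊨ FirstOrder.Language.Formula.equivSentence θ ↔ θ.Realize s := fun θ =>
      FirstOrder.Language.Formula.realize_equivSentence A.Carrier θ
    have hM : A.Carrier ⊨ (T₀ : (doubled L)[[ℕ]].Theory) := by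
      refine ⟨fun θ hθ => ?_⟩
      rcases hsub hθ with rfl | ⟨δ, hδ, rfl⟩
      · rw [hr, FirstOrder.Language.Formula.realize_not, (A.codes_classical.realize_classical φ s).1]
        exact h₂
      · rw [hr, (A.codes_classical.realize_classical δ s).1]
        exact h₁ δ hδ
    exact FirstOrder.Language.Theory.Model.isSatisfiable A.Carrier
  obtain ⟨M₀⟩ := hT
  -- The lift moves the model into the universe in which the consequence relation is taken.
  let M := FirstOrder.Language.Theory.ModelType.ulift.{_, _, _, w} M₀
  let : (doubled L).Structure M :=
    ((doubled L).lhomWithConstants ℕ).reduct M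
  have : ((doubled L).lhomWithConstants ℕ).IsExpansionOn M :=
    FirstOrder.Language.LHom.isExpansionOn_reduct _ _
  let A := FourStructure.ofClassical (L := L) M
  let s : ℕ → A.Carrier := fun a => ((doubled L).con a : M)
  have hr : ∀ θ : (doubled L).Formula ℕ,
      M ⊨ FirstOrder.Language.Formula.equivSentence θ ↔ θ.Realize s := fun θ =>
    FirstOrder.Language.Formula.realize_equivSentence M θ
  have hc := FourStructure.codes_ofClassical (L := L) M
  refine ⟨A, s, fun δ hδ => (hc.realize_classical δ s).1.1 ?_,
    fun hφ => ?_⟩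
  · exact (hr _).1 (M.is_model.realize_of_mem _ (Or.inr ⟨δ, hδ, rfl⟩))
  · exact FirstOrder.Language.Formula.realize_not.1
      ((hr _).1 (M.is_model.realize_of_mem _ (Or.inl rfl))) ((hc.realize_classical φ s).1.2 hφ)

/-! ### Simultaneous substitution and fresh variables -/

section Terms

variable {L : FirstOrder.Language.{u, v}}

theorem term_subst_congr {σ τ : ℕ → L.Term ℕ} (t : L.Term ℕ)
    (h : ∀ x ∈ t.varFinset, σ x = τ x) : t.subst σ = t.subst τ := by
  induction t with
  | var x => exact h x (by simp)
  | func f ts ih =>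
    simp only [FirstOrder.Language.Term.subst]
    congr 1
    funext i
    exact ih i fun x hx => h x (by simpa using ⟨i, hx⟩)

theorem term_subst_subst (σ τ : ℕ → L.Term ℕ) (t : L.Term ℕ) :
    (t.subst σ).subst τ = t.subst fun x => (σ x).subst τ := by
  induction t with
  | var x => rfl
  | func f ts ih => simp [ih]

theorem term_subst_eq_self {σ : ℕ → L.Term ℕ} (t : L.Term ℕ)
    (h : ∀ x ∈ t.varFinset, σ x = .var x) : t.subst σ = t :=
  (term_subst_congr t h).trans (UFormula.term_subst_var t)

theorem notMem_varFinset_subst {x : ℕ} {σ : ℕ → L.Term ℕ} (h : ∀ y, x ∉ (σ y).varFinset)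
    (t : L.Term ℕ) : x ∉ (t.subst σ).varFinset := by
  induction t with
  | var y => exact h y
  | func f ts ih => simpa using ih

/-- The function symbols that occur in a term. -/
def termFunctions : L.Term ℕ → Set (Σ k, L.Functions k)
  | .var _ => ∅
  | .func f ts => insert ⟨_, f⟩ (⋃ i, termFunctions (ts i))

theorem termFunctions_countable (t : L.Term ℕ) : (termFunctions t).Countable := by
  induction t with
  | var x => exact Set.countable_empty
  | func f ts ih => exact (Set.countable_iUnion ih).insert _

end Terms

namespace UFormula

variable {L : FirstOrder.Language.{u, v}}

/-- The variables that are bound by some quantifier. -/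
def boundVars : UFormula L → Finset ℕ
  | rel _ _ => ∅
  | and φ ψ => φ.boundVars ∪ ψ.boundVars
  | or φ ψ => φ.boundVars ∪ ψ.boundVars
  | imp φ ψ => φ.boundVars ∪ ψ.boundVars
  | neg φ => φ.boundVars
  | cons φ => φ.boundVars
  | all x φ => insert x φ.boundVars

/-- The function symbols that occur in a formula. -/
def functions : UFormula L → Set (Σ k, L.Functions k)
  | rel _ ts => ⋃ i, termFunctions (ts i)
  | and φ ψ => φ.functions ∪ ψ.functions
  | or φ ψ => φ.functions ∪ ψ.functions
  | imp φ ψ => φ.functions ∪ ψ.functions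
  | neg φ => φ.functions
  | cons φ => φ.functions
  | all _ φ => φ.functions

theorem functions_countable (φ : UFormula L) : φ.functions.Countable := by
  induction φ with
  | rel P ts => exact Set.countable_iUnion fun i => termFunctions_countable _
  | and φ ψ ih₁ ih₂ | or φ ψ ih₁ ih₂ | imp φ ψ ih₁ ih₂ => exact ih₁.union ih₂
  | neg φ ih | cons φ ih | all x φ ih => exact ih

/-- Simultaneous substitution for the free variables, without renaming of bound variables. -/
def msubst : UFormula L → (ℕ → L.Term ℕ) → UFormula L
  | rel P ts, σ => rel P fun i => (ts i).subst σ
  | and φ ψ, σ => and (φ.msubst σ) (ψ.msubst σ)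
  | or φ ψ, σ => or (φ.msubst σ) (ψ.msubst σ)
  | imp φ ψ, σ => imp (φ.msubst σ) (ψ.msubst σ)
  | neg φ, σ => neg (φ.msubst σ)
  | cons φ, σ => cons (φ.msubst σ)
  | all x φ, σ => all x (φ.msubst (Function.update σ x (.var x)))

theorem msubst_congr (φ : UFormula L) {σ τ : ℕ → L.Term ℕ} (h : ∀ x ∈ φ.freeVars, σ x = τ x) :
    φ.msubst σ = φ.msubst τ := by
  induction φ generalizing σ τ with
  | rel P ts =>
    simp only [msubst]
    congr 1
    funext i
    exact term_subst_congr _ fun x hx => h x (by simpa [freeVars] using ⟨i, hx⟩)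
  | and φ ψ ih₁ ih₂ | or φ ψ ih₁ ih₂ | imp φ ψ ih₁ ih₂ =>
    simp only [msubst]
    rw [ih₁ fun x hx => h x (Finset.mem_union_left _ hx),
      ih₂ fun x hx => h x (Finset.mem_union_right _ hx)]
  | neg φ ih | cons φ ih =>
    simp only [msubst]
    rw [ih h]
  | all x φ ih =>
    simp only [msubst]
    congr 1
    refine ih fun y hy => ?_
    by_cases hyx : y = x
    · simp [hyx]
    · simpa [hyx] using h y (Finset.mem_erase.2 ⟨hyx, hy⟩)

theorem msubst_var (φ : UFormula L) : φ.msubst FirstOrder.Language.Term.var = φ := by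
  induction φ with
  | rel P ts => simp [msubst, term_subst_var]
  | and φ ψ ih₁ ih₂ | or φ ψ ih₁ ih₂ | imp φ ψ ih₁ ih₂ => simp [msubst, ih₁, ih₂]
  | neg φ ih | cons φ ih => simp [msubst, ih]
  | all y φ ih => simp [msubst, ih]

theorem msubst_of_closed (φ : UFormula L) (h : φ.freeVars = ∅) (σ : ℕ → L.Term ℕ) :
    φ.msubst σ = φ :=
  (φ.msubst_congr (by simp [h])).trans φ.msubst_var

theorem boundVars_msubst (φ : UFormula L) (σ : ℕ → L.Term ℕ) :
    (φ.msubst σ).boundVars = φ.boundVars := by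
  induction φ generalizing σ with
  | rel P ts => rfl
  | and φ ψ ih₁ ih₂ | or φ ψ ih₁ ih₂ | imp φ ψ ih₁ ih₂ => simp [msubst, boundVars, ih₁, ih₂]
  | neg φ ih | cons φ ih | all y φ ih => simp [msubst, boundVars, ih]

theorem freeFor_of_disjoint {x : ℕ} {t : L.Term ℕ} (φ : UFormula L)
    (h : ∀ y ∈ φ.boundVars, y ∉ t.varFinset) : φ.FreeFor x t := by
  induction φ with
  | rel P ts => trivial
  | and φ ψ ih₁ ih₂ | or φ ψ ih₁ ih₂ | imp φ ψ ih₁ ih₂ =>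
    exact ⟨ih₁ fun y hy => h y (Finset.mem_union_left _ hy),
      ih₂ fun y hy => h y (Finset.mem_union_right _ hy)⟩
  | neg φ ih | cons φ ih => exact ih h
  | all y φ ih =>
    exact Or.inr ⟨h y (Finset.mem_insert_self _ _),
      ih fun z hz => h z (Finset.mem_insert_of_mem hz)⟩

/-- No term put in for another variable mentions x, so a later substitution for x reaches only the
original occurrences. This identifies instances of the body of ∀x with the formulas occurring in the
quantifier axioms. -/
theorem subst_msubst_update (φ : UFormula L) {σ : ℕ → L.Term ℕ} {x : ℕ} (t : L.Term ℕ)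
    (h : ∀ y, y ≠ x → x ∉ (σ y).varFinset) :
    (φ.msubst (Function.update σ x (.var x))).subst x t = φ.msubst (Function.update σ x t) := by
  induction φ generalizing σ with
  | rel P ts =>
    simp only [msubst, subst, term_subst_subst]
    congr 1
    funext i
    congr 1
    funext y
    by_cases hy : y = x
    · simp [hy]
    · simp only [Function.update_of_ne hy]
      exact term_subst_eq_self _ fun z hz =>
        Function.update_of_ne (ne_of_mem_of_not_mem hz (h y hy)) _ _
  | and φ ψ ih₁ ih₂ | or φ ψ ih₁ ih₂ | imp φ ψ ih₁ ih₂ =>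
    simp only [msubst, subst, ih₁ h, ih₂ h]
  | neg φ ih | cons φ ih => simp only [msubst, subst, ih h]
  | all y φ ih =>
    by_cases hy : y = x
    · subst hy
      simp [msubst, subst]
    · simp only [msubst, subst, hy, if_false]
      rw [Function.update_comm (Ne.symm hy), Function.update_comm (Ne.symm hy), ih]
      intro z hz
      by_cases hzy : z = y
      · simp [hzy, Ne.symm hy]
      · simpa [hzy] using h z hz

theorem notMem_freeVars_subst {x y : ℕ} (hxy : x ≠ y) (φ : UFormula L) :
    x ∉ (φ.subst x (.var y)).freeVars := by
  induction φ with
  | rel P ts =>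
    simp only [subst, freeVars, Finset.mem_biUnion, Finset.mem_univ, true_and, not_exists]
    intro i
    refine notMem_varFinset_subst (fun z => ?_) _
    by_cases hz : z = x
    · simpa [hz] using hxy
    · simpa [hz] using Ne.symm hz
  | and φ ψ ih₁ ih₂ | or φ ψ ih₁ ih₂ | imp φ ψ ih₁ ih₂ => simp [subst, freeVars, ih₁, ih₂]
  | neg φ ih | cons φ ih => simpa [subst, freeVars] using ih
  | all z φ ih =>
    by_cases hz : z = x
    · simp [subst, freeVars, hz]
    · simp [subst, freeVars, hz, ih]

theorem freeFor_subst_back {x y : ℕ} (φ : UFormula L) (hf : y ∉ φ.freeVars) :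
    (φ.subst x (.var y)).FreeFor y (.var x) := by
  induction φ with
  | rel P ts => trivial
  | and φ ψ ih₁ ih₂ | or φ ψ ih₁ ih₂ | imp φ ψ ih₁ ih₂ =>
    exact ⟨ih₁ fun h => hf (Finset.mem_union_left _ h),
      ih₂ fun h => hf (Finset.mem_union_right _ h)⟩
  | neg φ ih | cons φ ih => exact ih hf
  | all z φ ih =>
    by_cases hz : z = x
    · simp only [subst, hz, if_true]
      exact Or.inl (hz ▸ hf)
    · simp only [subst, hz, if_false]
      by_cases hzy : z = y
      · exact Or.inl (by simp [freeVars, hzy])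
      · exact Or.inr ⟨by simpa using hz,
          ih fun h => hf (Finset.mem_erase.2 ⟨Ne.symm hzy, h⟩)⟩

theorem subst_of_notMem {x : ℕ} {t : L.Term ℕ} (φ : UFormula L) (h : x ∉ φ.freeVars) :
    φ.subst x t = φ := by
  induction φ with
  | rel P ts =>
    simp only [subst]
    congr 1
    funext i
    refine term_subst_eq_self _ fun y hy => Function.update_of_ne ?_ _ _
    rintro rfl
    exact h (by simpa [freeVars] using ⟨i, hy⟩)
  | and φ ψ ih₁ ih₂ | or φ ψ ih₁ ih₂ | imp φ ψ ih₁ ih₂ =>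
    simp only [subst]
    rw [ih₁ fun hx => h (Finset.mem_union_left _ hx),
      ih₂ fun hx => h (Finset.mem_union_right _ hx)]
  | neg φ ih | cons φ ih =>
    simp only [subst]
    rw [ih h]
  | all y φ ih =>
    by_cases hy : y = x
    · simp [subst, hy]
    · simp only [subst, hy, if_false]
      rw [ih fun hx => h (Finset.mem_erase.2 ⟨Ne.symm hy, hx⟩)]

theorem subst_subst_back {x y : ℕ} (φ : UFormula L) (hf : y ∉ φ.freeVars)
    (hb : y ∉ φ.boundVars) : (φ.subst x (.var y)).subst y (.var x) = φ := by
  induction φ with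
  | rel P ts =>
    simp only [subst, term_subst_subst]
    congr 1
    funext i
    refine term_subst_eq_self _ fun z hz => ?_
    by_cases hzx : z = x
    · simp [hzx]
    · have hzy : z ≠ y := by
        rintro rfl
        exact hf (by simpa [freeVars] using ⟨i, hz⟩)
      simp [hzx, hzy]
  | and φ ψ ih₁ ih₂ | or φ ψ ih₁ ih₂ | imp φ ψ ih₁ ih₂ =>
    simp only [freeVars, boundVars, Finset.mem_union, not_or] at hf hb
    simp only [subst, ih₁ hf.1 hb.1, ih₂ hf.2 hb.2]
  | neg φ ih | cons φ ih => simp only [subst, ih hf hb]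
  | all z φ ih =>
    simp only [boundVars, Finset.mem_insert, not_or] at hb
    by_cases hz : z = x
    · simp only [subst, hz, if_true]
      exact (φ.all x).subst_of_notMem (hz ▸ hf)
    · simp only [subst, hz, if_false, Ne.symm hb.1]
      rw [ih (fun h => hf (Finset.mem_erase.2 ⟨hb.1, h⟩)) hb.2]

end UFormula

/-! ### Quantifier rules with a fresh variable -/

namespace Derivable

variable {L : FirstOrder.Language.{u, v}} {Δ : Set (UFormula L)} {α ψ : UFormula L} {x y : ℕ}

/-- Generalize over y, then rename back: x is not free in ∀y ψ[x/y], and freshness of y makes the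
renaming reversible. -/
theorem imp_all_of_fresh (hα : y ∉ α.freeVars) (hxy : x ≠ y) (hf : y ∉ ψ.freeVars)
    (hb : y ∉ ψ.boundVars) (h : Derivable Δ (α.imp (ψ.subst x (.var y)))) :
    Derivable Δ (α.imp (ψ.all x)) := by
  refine imp_trans (allIn1 y hα h) (allIn1 x ?_ ?_)
  · exact fun hx => ψ.notMem_freeVars_subst hxy (Finset.mem_of_mem_erase hx)
  · have := ax (Γ := Δ) (.allA y (.var x) _ (ψ.freeFor_subst_back (x := x) hf))
    rwa [ψ.subst_subst_back hf hb] at this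

/-- The dual renaming: ¬ψ implies ¬∀y ψ[x/y] by `allC`, hence so does ¬∀xψ. -/
theorem neg_all_imp_of_fresh (hα : y ∉ α.freeVars) (hxy : x ≠ y) (hf : y ∉ ψ.freeVars)
    (hb : y ∉ ψ.boundVars) (h : Derivable Δ ((ψ.subst x (.var y)).neg.imp α)) :
    Derivable Δ ((ψ.all x).neg.imp α) := by
  refine imp_trans (neg_all_imp ?_ ?_) (neg_all_imp hα h)
  · exact fun hx => ψ.notMem_freeVars_subst hxy (Finset.mem_of_mem_erase hx)
  · have := ax (Γ := Δ) (.allC y (.var x) _ (ψ.freeFor_subst_back (x := x) hf))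
    rwa [ψ.subst_subst_back hf hb] at this

end Derivable

/-! ### Henkin theories for countably many formulas -/

section Henkin

variable {L : FirstOrder.Language.{u, v}}

/-- A consistent theory over `Δ` that decides the formulas of `S` and has witnesses in `W` for the
universally quantified formulas of `S`. -/
structure IsHenkin (Δ S : Set (UFormula L)) (W : Set (L.Term ℕ)) (T : Set (UFormula L)) :
    Prop where
  of_derivable : ∀ {α}, Derivable Δ α → α ∈ T
  mp : ∀ {α β : UFormula L}, α.imp β ∈ T → α ∈ T → β ∈ T
  consistent : ∃ α, α ∉ T
  decides : ∀ {α}, α ∈ S → α ∈ T ∨ ∀ β, α.imp β ∈ T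
  witness : ∀ {x ψ}, UFormula.all x ψ ∈ S →
    UFormula.all x ψ ∈ T ∨ ∃ t ∈ W, ∀ β, (ψ.subst x t).imp β ∈ T
  neg_witness : ∀ {x ψ}, UFormula.all x ψ ∈ S →
    (UFormula.all x ψ).neg ∈ T → ∃ t ∈ W, (ψ.subst x t).neg ∈ T

/-- A form of the Rasiowa–Sikorski lemma: a theory that meets countably many requirements, each
of which can be met above every consistent formula. -/
theorem exists_generic {ι : Type*} [Countable ι] {Δ : Set (UFormula L)} {bot : UFormula L}
    (R : ι → UFormula L → Prop)
    (hR : ∀ i γ, ¬Derivable Δ (γ.imp bot) →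
      ∃ δ, ¬Derivable Δ (δ.imp bot) ∧ Derivable Δ (δ.imp γ) ∧ R i δ)
    {γ₀ : UFormula L} (hγ₀ : ¬Derivable Δ (γ₀.imp bot)) :
    ∃ T : Set (UFormula L), γ₀ ∈ T ∧ bot ∉ T ∧ (∀ α, Derivable Δ α → α ∈ T) ∧
      (∀ α β : UFormula L, α.imp β ∈ T → α ∈ T → β ∈ T) ∧
      ∀ i, ∃ γ, R i γ ∧ ∀ α, Derivable Δ (γ.imp α) → α ∈ T := by
  -- Conditions are the consistent formulas, and larger means stronger. An ideal is thus a directed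
  -- family of conditions, and `T` consists of their consequences.
  let P := {γ : UFormula L // ¬Derivable Δ (γ.imp bot)}
  let : Preorder P :=
    { le := fun γ δ => Derivable Δ (δ.1.imp γ.1)
      le_refl := fun _ => Derivable.imp_refl
      le_trans := fun _ _ _ h₁ h₂ => h₂.imp_trans h₁ }
  let : Encodable ι := Encodable.ofCountable ι
  let 𝒟 : ι → Order.Cofinal P := fun i =>
    { carrier := {γ | R i γ.1}
      isCofinal := fun γ => by
        obtain ⟨δ, h₁, h₂, h₃⟩ := hR i γ.1 γ.2
        exact ⟨⟨δ, h₁⟩, h₃, h₂⟩ }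
  let I := Order.idealOfCofinals (⟨γ₀, hγ₀⟩ : P) 𝒟
  have hI₀ : (⟨γ₀, hγ₀⟩ : P) ∈ I := Order.mem_idealOfCofinals _ _
  refine ⟨{α | ∃ γ ∈ I, Derivable Δ (γ.1.imp α)}, ⟨_, hI₀, Derivable.imp_refl⟩, ?_, ?_, ?_, ?_⟩
  · rintro ⟨γ, _, h⟩
    exact γ.2 h
  · exact fun α h => ⟨_, hI₀, h.weaken⟩
  · rintro α β ⟨γ, hγ, h₁⟩ ⟨δ, hδ, h₂⟩
    obtain ⟨ε, hε, h₃, h₄⟩ := I.directed γ hγ δ hδ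
    exact ⟨ε, hε, (Derivable.imp_trans h₃ h₁).imp_mp (Derivable.imp_trans h₄ h₂)⟩
  · intro i
    obtain ⟨γ, h₁, h₂⟩ := Order.cofinal_meets_idealOfCofinals (⟨γ₀, hγ₀⟩ : P) 𝒟 i
    exact ⟨γ.1, h₁, fun α h => ⟨γ, h₂, h⟩⟩

/-- There are three requirements for each formula of `S`: decision, a witness against ∀xψ, and a
witness for ¬∀xψ. A consistent γ meets the latter two outright or can be strengthened by ψ[x/y] → ⊥,
respectively ¬ψ[x/y], where y is a variable in `W` fresh for γ and ψ: were the result inconsistent,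
the rules for fresh variables would have given the first alternative. -/
theorem exists_isHenkin {Δ S : Set (UFormula L)} (hS : S.Countable) {W : Set (L.Term ℕ)}
    (hW : ∀ m, ∃ n, m ≤ n ∧ .var n ∈ W) {bot : UFormula L}
    (hbot : ∀ β, Derivable Δ (bot.imp β)) (hfv : bot.freeVars = ∅)
    {γ₀ : UFormula L} (hγ₀ : ¬Derivable Δ (γ₀.imp bot)) :
    ∃ T, IsHenkin Δ S W T ∧ γ₀ ∈ T ∧ bot ∉ T := by
  have := hS.to_subtype
  have fresh : ∀ (γ ψ : UFormula L) (x : ℕ), ∃ y, .var y ∈ W ∧ y ∉ γ.freeVars ∧ x ≠ y ∧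
      y ∉ ψ.freeVars ∧ y ∉ ψ.boundVars := by
    intro γ ψ x
    let V := insert x (γ.freeVars ∪ ψ.freeVars ∪ ψ.boundVars)
    obtain ⟨y, hy, hyW⟩ := hW (V.sup Nat.succ)
    have hyV : y ∉ V := fun h => by
      have : y + 1 ≤ V.sup Nat.succ := Finset.le_sup (f := Nat.succ) h
      omega
    simp only [V, Finset.mem_insert, Finset.mem_union, not_or] at hyV
    exact ⟨y, hyW, hyV.2.1.1, Ne.symm hyV.1, hyV.2.1.2, hyV.2.2⟩
  let R : S ⊕ S ⊕ S → UFormula L → Prop := Sum.elim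
    (fun α γ => Derivable Δ (γ.imp α.1) ∨ Derivable Δ (γ.imp (α.1.imp bot)))
    (Sum.elim
      (fun α γ => ∀ x ψ, α.1 = UFormula.all x ψ → Derivable Δ (γ.imp (ψ.all x)) ∨
        ∃ t ∈ W, Derivable Δ (γ.imp ((ψ.subst x t).imp bot)))
      (fun α γ => ∀ x ψ, α.1 = UFormula.all x ψ → Derivable Δ (γ.imp ((ψ.all x).neg.imp bot)) ∨
        ∃ t ∈ W, Derivable Δ (γ.imp (ψ.subst x t).neg)))
  obtain ⟨T, h₀, h₁, h₂, h₃, h₄⟩ := exists_generic (Δ := Δ) (bot := bot) R (by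
    rintro (α | α | α) γ hγ
    · by_cases h : Derivable Δ ((γ.and α.1).imp bot)
      · exact ⟨γ, hγ, Derivable.imp_refl, Or.inr h.curry⟩
      · exact ⟨_, h, .ax (.pos3 _ _), Or.inl (.ax (.pos4 _ _))⟩
    · by_cases hall : ∃ x ψ, α.1 = UFormula.all x ψ
      swap
      · exact ⟨γ, hγ, Derivable.imp_refl, fun x ψ h => absurd ⟨x, ψ, h⟩ hall⟩
      obtain ⟨x, ψ, hα⟩ := hall
      by_cases h : Derivable Δ (γ.imp (ψ.all x))
      · refine ⟨γ, hγ, Derivable.imp_refl, fun x' ψ' h' => ?_⟩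
        obtain ⟨rfl, rfl⟩ := UFormula.all.inj (hα.symm.trans h')
        exact Or.inl h
      obtain ⟨y, hyW, hγy, hxy, hf, hb⟩ := fresh γ ψ x
      refine ⟨γ.and ((ψ.subst x (.var y)).imp bot), fun h' => h ?_, .ax (.pos3 _ _),
        fun x' ψ' h' => ?_⟩
      · exact Derivable.imp_all_of_fresh hγy hxy hf hb
          (Derivable.imp_of_imp_imp (hbot _) h'.curry)
      · obtain ⟨rfl, rfl⟩ := UFormula.all.inj (hα.symm.trans h')
        exact Or.inr ⟨_, hyW, .ax (.pos4 _ _)⟩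
    · by_cases hall : ∃ x ψ, α.1 = UFormula.all x ψ
      swap
      · exact ⟨γ, hγ, Derivable.imp_refl, fun x ψ h => absurd ⟨x, ψ, h⟩ hall⟩
      obtain ⟨x, ψ, hα⟩ := hall
      by_cases h : Derivable Δ (γ.imp ((ψ.all x).neg.imp bot))
      · refine ⟨γ, hγ, Derivable.imp_refl, fun x' ψ' h' => ?_⟩
        obtain ⟨rfl, rfl⟩ := UFormula.all.inj (hα.symm.trans h')
        exact Or.inl h
      obtain ⟨y, hyW, hγy, hxy, hf, hb⟩ := fresh γ ψ x
      refine ⟨γ.and (ψ.subst x (.var y)).neg, fun h' => h ?_, .ax (.pos3 _ _),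
        fun x' ψ' h' => ?_⟩
      -- After the swap the succedent is γ → ⊥, for which y is fresh because ⊥ is closed.
      · refine (Derivable.neg_all_imp_of_fresh (y := y) ?_ hxy hf hb h'.curry.swap).swap
        simpa [UFormula.freeVars, hfv] using hγy
      · obtain ⟨rfl, rfl⟩ := UFormula.all.inj (hα.symm.trans h')
        exact Or.inr ⟨_, hyW, .ax (.pos4 _ _)⟩) hγ₀
  have explode : ∀ {α : UFormula L}, α.imp bot ∈ T → ∀ β, α.imp β ∈ T := fun {α} hα β =>
    h₃ _ _ (h₂ _ (Derivable.mp (.ax (.pos2 _ _ _)) (hbot β).weaken)) hα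
  refine ⟨T, ⟨h₂ _, h₃ _ _, ⟨bot, h₁⟩, fun {α} hα => ?_, fun {x ψ} hα => ?_,
    fun {x ψ} hα hn => ?_⟩, h₀, h₁⟩
  · obtain ⟨γ, h | h, hγ⟩ := h₄ (.inl ⟨α, hα⟩)
    · exact Or.inl (hγ _ h)
    · exact Or.inr (explode (hγ _ h))
  · obtain ⟨γ, hR, hγ⟩ := h₄ (.inr (.inl ⟨_, hα⟩))
    obtain h | ⟨t, ht, h⟩ := hR x ψ rfl
    · exact Or.inl (hγ _ h)
    · exact Or.inr ⟨t, ht, explode (hγ _ h)⟩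
  · obtain ⟨γ, hR, hγ⟩ := h₄ (.inr (.inr ⟨_, hα⟩))
    obtain h | ⟨t, ht, h⟩ := hR x ψ rfl
    · exact absurd (h₃ _ _ (hγ _ h) hn) h₁
    · exact ⟨t, ht, hγ _ h⟩

end Henkin

/-! ### The term model -/

section TermModel

variable {L : FirstOrder.Language.{u, v}} (F : Set (Σ k, L.Functions k)) (N : ℕ)

/-- The algebraic language with the function symbols of `F`. -/
def subLanguage : FirstOrder.Language.{u, 0} :=
  ⟨fun k => {f : L.Functions k // ⟨k, f⟩ ∈ F}, fun _ => Empty⟩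

/-- Terms over `F` as terms of `L` all of whose variables are at least `N`. -/
def embed : (subLanguage F).Term ℕ → L.Term ℕ
  | .var x => .var (x + N)
  | .func f ts => .func f.1 fun i => embed (ts i)

variable {F N} in
theorem le_of_mem_varFinset_embed {t : (subLanguage F).Term ℕ} {x : ℕ}
    (h : x ∈ (embed F N t).varFinset) : N ≤ x := by
  induction t with
  | var y =>
    simp only [embed, FirstOrder.Language.Term.varFinset, Finset.mem_singleton] at h
    omega
  | func f ts ih =>
    simp only [embed, FirstOrder.Language.Term.varFinset, Finset.mem_biUnion, Finset.mem_univ,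
      true_and] at h
    obtain ⟨i, hi⟩ := h
    exact ih i hi

variable {F} in
theorem countable_subLanguage_term (hF : F.Countable) : Countable ((subLanguage F).Term ℕ) := by
  have := hF.to_subtype
  have : Countable (Σ k, (subLanguage F).Functions k) :=
    Function.Injective.countable (β := F)
      (f := fun f : (Σ k, (subLanguage F).Functions k) => ⟨⟨f.1, f.2.1⟩, f.2.2⟩) (by
        rintro ⟨k, f, hf⟩ ⟨k', f', hf'⟩ h
        simp only [Subtype.mk.injEq, Sigma.mk.injEq] at h
        obtain ⟨rfl, h⟩ := h
        obtain rfl := eq_of_heq h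
        rfl)
  infer_instance

/-- The term model of a theory. Symbols outside `F` are interpreted arbitrarily. -/
noncomputable def termModel (T : Set (UFormula L)) : FourStructure.{u, v, u} L where
  Carrier := (subLanguage F).Term ℕ
  nonempty := ⟨.var 0⟩
  relMap P v := Four.ofProps (UFormula.rel P (fun i => embed F N (v i)) ∈ T)
    ((UFormula.rel P (fun i => embed F N (v i))).neg ∈ T)
  funMap {k} f v := open Classical in
    if h : ⟨k, f⟩ ∈ F then .func (L := subLanguage F) (l := k) ⟨f, h⟩ v else .var 0

/-- The instances of a formula by terms over `F`. -/
def instances (φ : UFormula L) : Set (UFormula L) :=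
  Set.range fun s : ℕ → (subLanguage F).Term ℕ => φ.msubst fun x => embed F N (s x)

/-- The instances of the subformulas of a formula and of their negations. -/
def subInstances : UFormula L → Set (UFormula L)
  | .rel P ts => instances F N (.rel P ts) ∪ instances F N (.neg (.rel P ts))
  | .and φ ψ => instances F N (.and φ ψ) ∪ instances F N (.neg (.and φ ψ)) ∪
      (subInstances φ ∪ subInstances ψ)
  | .or φ ψ => instances F N (.or φ ψ) ∪ instances F N (.neg (.or φ ψ)) ∪
      (subInstances φ ∪ subInstances ψ)
  | .imp φ ψ => instances F N (.imp φ ψ) ∪ instances F N (.neg (.imp φ ψ)) ∪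
      (subInstances φ ∪ subInstances ψ)
  | .neg φ => instances F N (.neg φ) ∪ instances F N (.neg (.neg φ)) ∪ subInstances φ
  | .cons φ => instances F N (.cons φ) ∪ instances F N (.neg (.cons φ)) ∪ subInstances φ
  | .all x φ => instances F N (.all x φ) ∪ instances F N (.neg (.all x φ)) ∪ subInstances φ

theorem instances_union_subset (φ : UFormula L) :
    instances F N φ ∪ instances F N φ.neg ⊆ subInstances F N φ := by
  cases φ with
  | rel P ts => exact subset_rfl
  | _ => exact Set.subset_union_left

/-- There are uncountably many assignments, but only their restrictions to the finite set of free
variables matter. -/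
theorem instances_countable (hF : F.Countable) (φ : UFormula L) :
    (instances F N φ).Countable := by
  have := countable_subLanguage_term hF
  refine (Set.countable_range fun s : φ.freeVars → (subLanguage F).Term ℕ =>
    φ.msubst fun x => embed F N (if h : x ∈ φ.freeVars then s ⟨x, h⟩ else .var 0)).mono ?_
  rintro _ ⟨s, rfl⟩
  exact ⟨fun x => s x, φ.msubst_congr fun x hx => by simp [hx]⟩

theorem subInstances_countable (hF : F.Countable) (φ : UFormula L) :
    (subInstances F N φ).Countable := by
  have h := fun φ : UFormula L =>
    (instances_countable F N hF φ).union (instances_countable F N hF φ.neg)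
  induction φ with
  | rel P ts => exact h _
  | and φ ψ ih₁ ih₂ | or φ ψ ih₁ ih₂ | imp φ ψ ih₁ ih₂ => exact (h _).union (ih₁.union ih₂)
  | neg φ ih | cons φ ih | all x φ ih => exact (h _).union ih

theorem embed_termVal {T : Set (UFormula L)} (t : L.Term ℕ) (ht : termFunctions t ⊆ F)
    (s : ℕ → (subLanguage F).Term ℕ) :
    embed F N ((termModel F N T).termVal s t) = t.subst fun x => embed F N (s x) := by
  induction t with
  | var x => rfl
  | @func k f ts ih =>
    have hf : ⟨k, f⟩ ∈ F := ht (Set.mem_insert _ _)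
    simp only [FourStructure.termVal, termModel, hf, dif_pos, embed,
      FirstOrder.Language.Term.subst]
    congr 1
    funext i
    exact ih i ((Set.subset_iUnion _ i).trans ((Set.subset_insert _ _).trans ht))

end TermModel

/-! ### Membership in a Henkin theory and the truth lemma -/

namespace IsHenkin

variable {L : FirstOrder.Language.{u, v}} {Δ S T : Set (UFormula L)} {W : Set (L.Term ℕ)}
  {α β : UFormula L}

theorem mem_of_ax_imp (hT : IsHenkin Δ S W T) (h : HilbertAx (α.imp β)) (hα : α ∈ T) : β ∈ T :=
  hT.mp (hT.of_derivable (.ax h)) hα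

theorem and_mem_iff (hT : IsHenkin Δ S W T) : α.and β ∈ T ↔ α ∈ T ∧ β ∈ T :=
  ⟨fun h => ⟨hT.mem_of_ax_imp (.pos3 _ _) h, hT.mem_of_ax_imp (.pos4 _ _) h⟩,
    fun h => hT.mp (hT.mem_of_ax_imp (.pos5 _ _) h.1) h.2⟩

theorem mem_iff_of_ax_iff (hT : IsHenkin Δ S W T) (h : HilbertAx (α.iff β)) :
    α ∈ T ↔ β ∈ T := by
  have := hT.and_mem_iff.1 (hT.of_derivable (.ax h))
  exact ⟨hT.mp this.1, hT.mp this.2⟩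

/-- If α is decided negatively, α → β is in `T`, and with β → β the disjunction yields β. Only one
disjunct has to be decided. -/
theorem or_mem_iff (hT : IsHenkin Δ S W T) (hα : α ∈ S) : α.or β ∈ T ↔ α ∈ T ∨ β ∈ T := by
  refine ⟨fun h => (hT.decides hα).imp_right fun hn => ?_, ?_⟩
  · exact hT.mp (hT.mp (hT.mem_of_ax_imp (.pos8 α β β) (hn β))
      (hT.of_derivable Derivable.imp_refl)) h
  · rintro (h | h)
    · exact hT.mem_of_ax_imp (.pos6 _ _) h
    · exact hT.mem_of_ax_imp (.pos7 _ _) h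

theorem imp_mem_iff (hT : IsHenkin Δ S W T) (hα : α ∈ S) :
    α.imp β ∈ T ↔ (α ∈ T → β ∈ T) := by
  refine ⟨hT.mp, fun h => ?_⟩
  rcases hT.decides hα with h' | h'
  · exact hT.mem_of_ax_imp (.pos1 _ _) (h h')
  · exact h' β

theorem cons_mem_iff (hT : IsHenkin Δ S W T) (hα : α ∈ S) (hn : α.neg ∈ S) :
    α.cons ∈ T ↔ ¬(α ∈ T ∧ α.neg ∈ T) := by
  constructor
  · rintro h h'
    obtain ⟨β, hβ⟩ := hT.consistent
    exact hβ (hT.mem_of_ax_imp (.cons1 α β) (hT.and_mem_iff.2 ⟨h, hT.and_mem_iff.2 h'⟩))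
  · intro h
    -- By `cons2` it remains to treat the case α ∧ ¬α; one of its conjuncts is missing from `T`,
    -- hence implies everything there.
    have key : (α.and α.neg).imp α.cons ∈ T := by
      rcases hT.decides hα with h₁ | h₁
      · rcases hT.decides hn with h₂ | h₂
        · exact absurd ⟨h₁, h₂⟩ h
        · exact hT.mp (hT.mem_of_ax_imp (.pos2 _ _ _) (hT.mem_of_ax_imp (.pos1 _ _) (h₂ _)))
            (hT.of_derivable (.ax (.pos4 _ _)))
      · exact hT.mp (hT.mem_of_ax_imp (.pos2 _ _ _) (hT.mem_of_ax_imp (.pos1 _ _) (h₁ _)))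
          (hT.of_derivable (.ax (.pos3 _ _)))
    exact hT.mp (hT.mp (hT.mem_of_ax_imp (.pos8 _ _ _) (hT.of_derivable Derivable.imp_refl)) key)
      (hT.of_derivable (.ax (.cons2 α)))

variable {F : Set (Σ k, L.Functions k)} {N : ℕ}

/-- The truth lemma for the term model of a Henkin theory. -/
theorem des_val_termModel (hT : IsHenkin Δ S (Set.range (embed F N)) T) (φ : UFormula L)
    (hF : φ.functions ⊆ F) (hN : ∀ x ∈ φ.boundVars, x < N) (hS : subInstances F N φ ⊆ S)
    (s : ℕ → (subLanguage F).Term ℕ) :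
    (((termModel F N T).val φ.toFormula s).Des ↔ φ.msubst (fun x => embed F N (s x)) ∈ T) ∧
      (((termModel F N T).val φ.toFormula s).neg.Des ↔
        (φ.msubst fun x => embed F N (s x)).neg ∈ T) := by
  have inst : ∀ {ψ : UFormula L}, subInstances F N ψ ⊆ S → ∀ s : ℕ → (subLanguage F).Term ℕ,
      ψ.msubst (fun x => embed F N (s x)) ∈ S ∧
        (ψ.msubst fun x => embed F N (s x)).neg ∈ S := fun {ψ} hψ s =>
    ⟨hψ (instances_union_subset F N ψ (Or.inl ⟨s, rfl⟩)),
      hψ (instances_union_subset F N ψ (Or.inr ⟨s, rfl⟩))⟩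
  induction φ generalizing s with
  | rel P ts =>
    have e : (fun i => embed F N ((termModel F N T).termVal s (ts i))) =
        fun i => (ts i).subst fun x => embed F N (s x) :=
      funext fun i => embed_termVal F N _ ((Set.subset_iUnion _ i).trans hF) s
    simp only [UFormula.toFormula, UFormula.msubst, ← e]
    exact ⟨Four.des_ofProps _ _, Four.des_neg_ofProps _ _⟩
  | and φ ψ ih₁ ih₂ =>
    obtain ⟨hF₁, hF₂⟩ := Set.union_subset_iff.1 hF
    obtain ⟨hS₁, hS₂⟩ := Set.union_subset_iff.1 (Set.union_subset_iff.1 hS).2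
    have h₁ := ih₁ hF₁ (fun x hx => hN x (Finset.mem_union_left _ hx)) hS₁ s
    have h₂ := ih₂ hF₂ (fun x hx => hN x (Finset.mem_union_right _ hx)) hS₂ s
    simp only [UFormula.toFormula, FourStructure.val, UFormula.msubst, Four.des_and,
      Four.des_neg_and, h₁, h₂, hT.and_mem_iff, hT.mem_iff_of_ax_iff (.dm2 _ _),
      hT.or_mem_iff (inst hS₁ s).2, and_self]
  | or φ ψ ih₁ ih₂ =>
    obtain ⟨hF₁, hF₂⟩ := Set.union_subset_iff.1 hF
    obtain ⟨hS₁, hS₂⟩ := Set.union_subset_iff.1 (Set.union_subset_iff.1 hS).2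
    have h₁ := ih₁ hF₁ (fun x hx => hN x (Finset.mem_union_left _ hx)) hS₁ s
    have h₂ := ih₂ hF₂ (fun x hx => hN x (Finset.mem_union_right _ hx)) hS₂ s
    simp only [UFormula.toFormula, FourStructure.val, UFormula.msubst, Four.des_or,
      Four.des_neg_or, h₁, h₂, hT.and_mem_iff, hT.mem_iff_of_ax_iff (.dm1 _ _),
      hT.or_mem_iff (inst hS₁ s).1, and_self]
  | imp φ ψ ih₁ ih₂ =>
    obtain ⟨hF₁, hF₂⟩ := Set.union_subset_iff.1 hF
    obtain ⟨hS₁, hS₂⟩ := Set.union_subset_iff.1 (Set.union_subset_iff.1 hS).2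
    have h₁ := ih₁ hF₁ (fun x hx => hN x (Finset.mem_union_left _ hx)) hS₁ s
    have h₂ := ih₂ hF₂ (fun x hx => hN x (Finset.mem_union_right _ hx)) hS₂ s
    simp only [UFormula.toFormula, FourStructure.val, UFormula.msubst, Four.des_imp,
      Four.des_neg_imp, h₁, h₂, hT.and_mem_iff, hT.mem_iff_of_ax_iff (.dm3 _ _),
      hT.imp_mem_iff (inst hS₁ s).1, hT.imp_mem_iff (inst hS₁ s).2, and_self]
  | neg φ ih =>
    have h := ih hF hN (Set.union_subset_iff.1 hS).2 s
    simp only [UFormula.toFormula, FourStructure.val, UFormula.msubst, Four.neg_neg, h,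
      hT.mem_iff_of_ax_iff (.dneg _), and_self]
  | cons φ ih =>
    have hS' := (Set.union_subset_iff.1 hS).2
    have h := ih hF hN hS' s
    have hi := inst hS' s
    simp only [UFormula.toFormula, FourStructure.val, UFormula.msubst, Four.des_cons,
      Four.des_neg_cons, h, hT.cons_mem_iff hi.1 hi.2, hT.mem_iff_of_ax_iff (.cons3 _),
      UFormula.iff, hT.and_mem_iff, hT.imp_mem_iff hi.1, hT.imp_mem_iff hi.2, true_and]
    exact iff_iff_implies_and_implies
  | all x φ ih =>
    have hS' := (Set.union_subset_iff.1 hS).2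
    have hx : x < N := hN x (Finset.mem_insert_self _ _)
    have h := fun a => ih hF (fun y hy => hN y (Finset.mem_insert_of_mem hy)) hS'
      (Function.update s x a)
    have hi := (inst hS s).1
    -- The instance of the body in which x stays a variable. Embedded terms contain only variables
    -- from `N` on, and bound variables lie below `N`, so no capture occurs.
    set ψ := φ.msubst (Function.update (fun y => embed F N (s y)) x (.var x)) with hψ
    have hsub : ∀ a, φ.msubst (fun y => embed F N (Function.update s x a y)) =
        ψ.subst x (embed F N a) := by
      intro a
      rw [hψ, φ.subst_msubst_update]
      · congr 1
        funext y
        by_cases hy : y = x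
        · subst hy; simp
        · simp [hy]
      · exact fun y _ hmem => absurd (le_of_mem_varFinset_embed hmem) (by omega)
    have hfree : ∀ a, ψ.FreeFor x (embed F N a) := fun a =>
      ψ.freeFor_of_disjoint fun y hy hmem => by
        rw [hψ, UFormula.boundVars_msubst] at hy
        have h₁ := hN y (Finset.mem_insert_of_mem hy)
        have h₂ := le_of_mem_varFinset_embed hmem
        omega
    have hall : (φ.all x).msubst (fun y => embed F N (s y)) = ψ.all x := rfl
    rw [hall] at hi ⊢
    simp only [hsub] at h
    simp only [UFormula.toFormula, FourStructure.val, Four.des_iInf, Four.des_neg_iInf]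
    constructor
    · constructor
      · intro H
        refine (hT.witness hi).resolve_right ?_
        -- Witnesses lie in the range of `embed`, so each is an element of the carrier.
        rintro ⟨_, ⟨a, rfl⟩, ha⟩
        obtain ⟨β, hβ⟩ := hT.consistent
        exact hβ (hT.mp (ha β) ((h a).1.1 (H a)))
      · exact fun H a => (h a).1.2 (hT.mem_of_ax_imp (.allA x _ ψ (hfree a)) H)
    · constructor
      · rintro ⟨a, ha⟩
        exact hT.mem_of_ax_imp (.allC x _ ψ (hfree a)) ((h a).2.1 ha)
      · intro H
        obtain ⟨_, ⟨a, rfl⟩, ha⟩ := hT.neg_witness hi H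
        exact ⟨a, (h a).2.2 ha⟩

end IsHenkin

/-! ### Completeness -/

section Completeness

variable {L : FirstOrder.Language.{u, v}}

/-- Finite sets of sentences have models that refute a given underivable sentence. -/
theorem exists_structure_of_not_derivable {Δ : Set (UFormula L)} (hfin : Δ.Finite)
    (hΔ : ∀ δ ∈ Δ, δ.freeVars = ∅) {φ : UFormula L} (hφ : φ.freeVars = ∅)
    (h : ¬Derivable Δ φ) :
    ∃ (A : FourStructure.{u, v, u} L) (s : ℕ → A.Carrier),
      (∀ δ ∈ Δ, (A.val δ.toFormula s).Des) ∧ ¬(A.val φ.toFormula s).Des := by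
  let Θ := insert φ Δ
  have hΘ : Θ.Finite := hfin.insert φ
  let F : Set (Σ k, L.Functions k) := ⋃ θ ∈ Θ, θ.functions
  have hF : F.Countable := hΘ.countable.biUnion fun θ _ => θ.functions_countable
  let N := (hΘ.toFinset.biUnion UFormula.boundVars).sup Nat.succ
  have hN : ∀ θ ∈ Θ, ∀ x ∈ θ.boundVars, x < N := fun θ hθ x hx =>
    Finset.le_sup (f := Nat.succ) (Finset.mem_biUnion.2 ⟨θ, hΘ.mem_toFinset.2 hθ, hx⟩)
  let S : Set (UFormula L) := ⋃ θ ∈ Θ, subInstances F N θ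
  have hS : S.Countable := hΘ.countable.biUnion fun θ _ => subInstances_countable F N hF θ
  let bot : UFormula L := φ.cons.and (φ.and φ.neg)
  have hbot : ∀ β, Derivable Δ (bot.imp β) := fun β => .ax (.cons1 φ β)
  have hfv : bot.freeVars = ∅ := by simp [bot, UFormula.freeVars, hφ]
  -- Double negation elimination is applied under the antecedent ⊥ → φ, which is itself derivable
  -- and then discharged.
  have hγ : ¬Derivable Δ ((φ.imp bot).imp bot) := fun h' =>
    h (Derivable.mp (Derivable.imp_of_imp_imp (hbot φ) h'.weaken) (hbot φ))
  obtain ⟨T, hT, hφT, hbotT⟩ := exists_isHenkin hS (W := Set.range (embed F N))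
    (fun m => ⟨m + N, by omega, .var m, rfl⟩) hbot hfv hγ
  have truth := fun θ (hθ : θ ∈ Θ) (s : ℕ → (subLanguage F).Term ℕ) =>
    (hT.des_val_termModel θ (Set.subset_biUnion_of_mem (u := UFormula.functions) hθ) (hN θ hθ)
      (Set.subset_biUnion_of_mem (u := subInstances F N) hθ) s).1
  refine ⟨termModel F N T, fun _ => (.var 0 : (subLanguage F).Term ℕ), fun δ hδ => ?_, fun H => ?_⟩
  · refine (truth δ (Or.inr hδ) _).2 ?_
    rw [δ.msubst_of_closed (hΔ δ hδ)]
    exact hT.of_derivable (.hyp hδ)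
  · have H' := (truth φ (Or.inl rfl) _).1 H
    rw [φ.msubst_of_closed hφ] at H'
    exact hbotT (hT.mp hφT H')

theorem derivable_of_consequence {Δ : Set (UFormula L)} {φ : UFormula L}
    (h : Consequence.{u, v, max u v w} (UFormula.toFormula '' Δ) φ.toFormula) :
    Derivable Δ φ := by
  by_contra hd
  -- Compactness concerns a single assignment while consequence quantifies over all of them; for
  -- closures the two agree.
  obtain ⟨A, s, h₁, h₂⟩ := exists_structure_of_finite.{u, v, w, u} (UFormula.close '' Δ) φ.close
    (fun Δ₀ hΔ₀ hfin => by
      refine exists_structure_of_not_derivable hfin (fun δ hδ => ?_) φ.freeVars_close fun h' => ?_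
      · obtain ⟨δ', -, rfl⟩ := hΔ₀ hδ
        exact δ'.freeVars_close
      · refine hd (φ.derivable_close_iff.1 (h'.trans_hyp fun δ hδ => ?_))
        obtain ⟨δ', hδ', rfl⟩ := hΔ₀ hδ
        exact δ'.derivable_close_iff.2 (.hyp hδ'))
  refine h₂ ((A.isModel_close_iff φ).2 (h A ?_) s)
  rintro _ ⟨δ, hδ, rfl⟩
  refine (A.isModel_close_iff δ).1 fun s' => ?_
  rw [A.val_congr δ.close (s' := s) (by simp [δ.freeVars_close])]
  exact h₁ _ ⟨δ, hδ, rfl⟩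

theorem consequence_iff_derivable (Δ : Set (UFormula L)) (φ : UFormula L) :
    Consequence.{u, v, max u v w} (UFormula.toFormula '' Δ) φ.toFormula ↔ Derivable Δ φ :=
  ⟨derivable_of_consequence, fun h A hA =>
    A.isModel_of_derivable h fun δ hδ => hA _ ⟨δ, hδ, rfl⟩⟩

theorem consequence_unfoldEx_iff (Δ : Set (Formula L)) (φ : Formula L) :
    Consequence.{u, v, w} (UFormula.toFormula '' (Formula.unfoldEx '' Δ)) φ.unfoldEx.toFormula ↔
      Consequence.{u, v, w} Δ φ := by
  simp only [Consequence, Set.forall_mem_image, FourStructure.isModel_unfoldEx]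

end Completeness

end QBD2

theorem mainTheorem1 (L : FirstOrder.Language.{u, v}) :
    (∀ (Δ : Set (QBD2.UFormula L)) (φ : QBD2.UFormula L),
      QBD2.Consequence.{u, v, max u v w} (QBD2.UFormula.toFormula '' Δ) φ.toFormula ↔
        QBD2.Derivable Δ φ) ∧
    (∀ (Δ : Set (QBD2.Formula L)) (φ : QBD2.Formula L),
      QBD2.Consequence.{u, v, max u v w} Δ φ ↔
        QBD2.Derivable (QBD2.Formula.unfoldEx '' Δ) φ.unfoldEx) :=
  ⟨QBD2.consequence_iff_derivable.{u, v, w}, fun Δ φ =>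
    (QBD2.consequence_unfoldEx_iff Δ φ).symm.trans
      (QBD2.consequence_iff_derivable.{u, v, w} _ _)⟩
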